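/- Let $a<b$, $n\ge 0$, and let $\mathcal P([a,b])$ be the set of Borel probability measures on $[a,b]$. For $k\ge 0$ let $M_k=\{(\int x\,d\mu,\dots,\int x^k\,d\mu) : \mu\in\mathcal P([a,b])\}\subset\mathbb R^k$ be the $k$-th moment space. For a moment vector $(c_1,\dots,c_m)\in M_m$ and $1\le k\le m$ let $c_k^{+}$ and $c_k^{-}$ be the largest and smallest $t$ with $(c_1,\dots,c_{k-1},t)\in M_k$; the $k$-th canonical moment is $p_k=\frac{c_k-c_k^-}{c_k^+-c_k^-}$ if $c_k^-<c_k^+$, and $p_k=0$ if $c_k^-=c_k^+$. Fix $\mathbf c_n=(c_1,\dots,c_n)\in M_n$ with canonical moments $p_1,\dots,p_n$, and let $$\mathcal A_\Delta=\Big\{\mu=\sum_{i=1}^{n+1}\omega_i\delta_{x_i}\in\mathcal P([a,b]) : \int x^j\,d\mu=c_j,\ j=1,\dots,n\Big\}$$ (the points $x_i$ need not be distinct and weights may vanish, so these are the measures supported on at most $n+1$ points). Let $\Gamma_{\mathbf c_n}$ be the set of all $(p_{n+1},\dots,p_{2n+1})\in[0,1]^{n+1}$ such that in the whole sequence $p_1,\dots,p_{2n+1}$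 the following holds: if $p_i\in\{0,1\}$ for some $1\le i\le 2n+1$, then $p_k=0$ for all $k>i$ with $n+1\le k\le 2n+1$. Then: 1. If $\mathbf c_n$ is an interior point of $M_n$, then $\Gamma_{\mathbf c_n}$ is the set $\Gamma=\{(p_{n+1},\dots,p_{2n+1})\in[0,1]^{n+1} : p_i\in\{0,1\}\Rightarrow p_k=0 \text{ for } k>i\}$, where only indices $i,k\in\{n+1,\dots,2n+1\}$ occur. If $\mathbf c_n$ is a boundary point of $M_n$, then $\Gamma_{\mathbf c_n}=\{(0,\dots,0)\}$. 2. The map that sends $\mu$ to the canonical moments $(p_{n+1},\dots,p_{2n+1})$ of its moment vector of length $2n+1$ is a bijection from $\mathcal A_\Delta$ onto $\Gamma_{\mathbf c_n}$. 3. The inverse is obtained as follows. For $(p_{n+1},\dots,p_{2n+1})\in\Gamma_{\mathbf c_n}$ put $\zeta_0=0$, $\zeta_1=p_1$, $\zeta_k=(1-p_{k-1})p_k$ for $2\le k\le 2n+1$, $P_*^{(-1)}=0$, $P_*^{(0)}=1$ and, for $0\le k\le n$, $$P_*^{(k+1)}(x)=\big(x-a-(b-a)(\zeta_{2k}+\zeta_{2k+1})\big)P_*^{(k)}(x)-(b-a)^2\zeta_{2k-1}\zeta_{2k}P_*^{(k-1)}(x)$$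 (for $k=0$ the last term is $0$). Then $P_*^{(n+1)}$ has $n+1$ real roots, counted with multiplicity, and all of them lie in $[a,b]$. There is exactly one probability measure on $[a,b]$ that is carried by the set of these roots and has moments $c_1,\dots,c_n$; it is the measure $\mu\in\mathcal A_\Delta$ that corresponds to $(p_{n+1},\dots,p_{2n+1})$. The support of $\mu$ is contained in the set of roots of $P_*^{(n+1)}$, and is equal to it if $\mu$ is supported on exactly $n+1$ points. -/

import Mathlib

open MeasureTheory Set Polynomial

namespace CanonicalMoments

/-- The set `𝒫([a,b])` of Borel probability measures on the real line that are carried by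
`[a,b]`. -/
def probOn (a b : ℝ) : Set (Measure ℝ) :=
  {μ | IsProbabilityMeasure μ ∧ μ (Icc a b)ᶜ = 0}

/-- The vector `(c₁, …, c_n)` of the first `n` moments of `μ`. The entry with (zero-based) index
`i` is the moment of order `i + 1`. -/
noncomputable def momentVec (n : ℕ) (μ : Measure ℝ) : Fin n → ℝ :=
  fun i => ∫ x, x ^ ((i : ℕ) + 1) ∂μ

/-- The `n`-th moment space `M_n` of `[a,b]`. -/
def momentSpace (a b : ℝ) (n : ℕ) : Set (Fin n → ℝ) :=
  momentVec n '' probOn a b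

/-- The possible values of the moment of order `n + 1` when the first `n` moments are `c`. -/
def nextMoments (a b : ℝ) {n : ℕ} (c : Fin n → ℝ) : Set ℝ :=
  {t | (Fin.snoc c t : Fin (n + 1) → ℝ) ∈ momentSpace a b (n + 1)}

/-- The largest possible moment `c⁺` of order `n + 1` (for `c ∈ M_n` and `a ≤ b` the set of
possible values is nonempty and compact, so that the supremum is a maximum). -/
noncomputable def nextMax (a b : ℝ) {n : ℕ} (c : Fin n → ℝ) : ℝ :=
  sSup (nextMoments a b c)

/-- The smallest possible moment `c⁻` of order `n + 1`. -/
noncomputable def nextMin (a b : ℝ) {n : ℕ} (c : Fin n → ℝ) : ℝ :=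
  sInf (nextMoments a b c)

/-- The canonical moments `(p₁, …, p_n)` of a moment vector `(c₁, …, c_n)`,
`p_k = (c_k - c_k⁻) / (c_k⁺ - c_k⁻)`, where `c_k⁻`, `c_k⁺` are the extreme values given
`c₁, …, c_{k-1}`. As soon as `c_k⁻ = c_k⁺` (that is, after the first degree `N` at which the
moment vector is a boundary point of `M_N`) the quotient is `0 / 0 = 0`, so that the sequence is
continued by zeros. -/
noncomputable def canonicalMoments (a b : ℝ) {n : ℕ} (c : Fin n → ℝ) : Fin n → ℝ :=
  fun k =>
    let d : Fin (k : ℕ) → ℝ := fun j => c (Fin.castLE k.isLt.le j)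
    (c k - nextMin a b d) / (nextMax a b d - nextMin a b d)

/-- The tail `(p_{n+1}, …, p_{2n+1})` of the canonical moments of a measure. -/
noncomputable def tailMoments (a b : ℝ) (n : ℕ) (μ : Measure ℝ) : Fin (n + 1) → ℝ :=
  fun i => canonicalMoments a b (momentVec (n + (n + 1)) μ) (Fin.natAdd n i)

/-- The set `𝒜_Δ` of the probability measures `∑_{i=1}^{n+1} ω_i δ_{x_i}` on `[a,b]` whose first
`n` moments are `c`. The points `x_i` need not be distinct and weights may vanish. -/
def discreteMeasures (a b : ℝ) {n : ℕ} (c : Fin n → ℝ) : Set (Measure ℝ) :=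
  {μ | μ ∈ probOn a b ∧
    (∃ (w : Fin (n + 1) → NNReal) (x : Fin (n + 1) → ℝ),
      (∀ i, x i ∈ Icc a b) ∧ μ = ∑ i, w i • Measure.dirac (x i)) ∧
    momentVec n μ = c}

/-- The set `Γ ⊆ [0,1]^{n+1}`: a value `0` or `1` forces all later entries to be `0`. -/
def Gamma (n : ℕ) : Set (Fin (n + 1) → ℝ) :=
  {q | (∀ i, q i ∈ Icc (0 : ℝ) 1) ∧ ∀ i k, i < k → (q i = 0 ∨ q i = 1) → q k = 0}

/-- The set `Γ(p)` of the tails `(p_{n+1}, …, p_{2n+1}) ∈ [0,1]^{n+1}` such that in the whole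
sequence `(p₁, …, p_{2n+1})` that starts with the given `p = (p₁, …, p_n)`, a value `0` or `1`
(at any place, also among the first `n`) forces all later entries of the tail to be `0`. -/
def GammaAfter {n : ℕ} (p : Fin n → ℝ) : Set (Fin (n + 1) → ℝ) :=
  {q | (∀ i, q i ∈ Icc (0 : ℝ) 1) ∧
    ∀ (i : Fin (n + (n + 1))) (k : Fin (n + 1)), i < Fin.natAdd n k →
      (Fin.append p q i = 0 ∨ Fin.append p q i = 1) → q k = 0}

/-- The entry `p_k` (`k ≥ 1`) of a finite sequence `(p₁, …, p_N)`, with `p₀ = 0`, and `0` for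
`k > N`. -/
def entry {N : ℕ} (p : Fin N → ℝ) : ℕ → ℝ
  | 0 => 0
  | k + 1 => if h : k < N then p ⟨k, h⟩ else 0

/-- `ζ_k = (1 - p_{k-1}) p_k` for `k ≥ 1` (so `ζ₁ = p₁`), and `ζ₀ = 0`. -/
def zeta {N : ℕ} (p : Fin N → ℝ) : ℕ → ℝ
  | 0 => 0
  | k + 1 => (1 - entry p k) * entry p (k + 1)

/-- The polynomials `P_*^{(k)}` of the three-term recursion
`P_*^{(k+1)} = (x - a - (b-a)(ζ_{2k} + ζ_{2k+1})) P_*^{(k)} - (b-a)² ζ_{2k-1} ζ_{2k} P_*^{(k-1)}`,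
`P_*^{(-1)} = 0`, `P_*^{(0)} = 1`. -/
noncomputable def Pstar (a b : ℝ) {N : ℕ} (p : Fin N → ℝ) : ℕ → ℝ[X]
  | 0 => 1
  | 1 => X - C (a + (b - a) * (zeta p 0 + zeta p 1))
  | k + 2 =>
      (X - C (a + (b - a) * (zeta p (2 * (k + 1)) + zeta p (2 * (k + 1) + 1)))) *
          Pstar a b p (k + 1)
        - C ((b - a) ^ 2 * (zeta p (2 * (k + 1) - 1) * zeta p (2 * (k + 1)))) * Pstar a b p k

/-- The polynomial `P_*^{(n+1)}` built from the canonical moments `p₁, …, p_n` of `c` followed by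
the tail `q = (p_{n+1}, …, p_{2n+1})`. -/
noncomputable def supportPoly (a b : ℝ) {n : ℕ} (c : Fin n → ℝ) (q : Fin (n + 1) → ℝ) : ℝ[X] :=
  Pstar a b (Fin.append (canonicalMoments a b c) q) (n + 1)

end CanonicalMoments

/-! A sequence `p` in `[0,1]` with `p 0 = 0` defines, through the `ζ_k`, a symmetric Jacobi matrix
with characteristic polynomial `P_*^{(n+1)}`. The spectral measure at its first basis vector is
carried by the roots of that polynomial and has the `P_*^{(k)}`, `k ≤ n + 1`, as orthogonal
polynomials (`exists_isRepresentedBy`). Nothing is divided by an off-diagonal entry, so sequences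
containing `0` or `1` are covered as well. The roots lie in `[a,b]` because companion polynomials
for the weights `x - a` and `b - x` obey two-term relations with coefficients of fixed sign.

Squares of the polynomials orthogonal for the weights `1`, `x - a`, `b - x`, `(x - a)(b - x)`, times
their weights, are nonnegative on `[a,b]` with leading coefficient `1` or `-1`. Their integrals are
`W p_{k+1}` and `W (1 - p_{k+1})`, where `W` is `momentWidth` at `k`. Hence, given the moments up to
order `k`, the next one ranges over an interval of length `W`, whose ends are reached by setting
`p_{k+1}` to `0` or `1`. So `p_{k+1}` is the canonical moment as long as `W ≠ 0`, and every measure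
shares its moments, up to any given order, with a spectral measure built from its own canonical
moments (`IsRepresentedBy.moment_eq_of_canonicalSeq`). This gives surjectivity and the description
of the inverse.

Uniqueness is interpolation (`measure_eq_of_finset`): two measures in `𝒜_Δ` live on at most `2n + 2`
points and share the moments of orders `0, …, 2n + 1`; on the roots alone, orders `0, …, n` suffice.
-/

namespace CanonicalMoments

/-! ### Orthogonal polynomials for the four weights: algebraic identities. -/

/-- `ζ_k` for a sequence indexed by all natural numbers. -/
def chainCoeff (p : ℕ → ℝ) : ℕ → ℝ
  | 0 => 0
  | k + 1 => (1 - p k) * p (k + 1)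

/-- The monic orthogonal polynomials of the measure with canonical moments `p`. -/
noncomputable def orthPoly (a b : ℝ) (p : ℕ → ℝ) : ℕ → ℝ[X]
  | 0 => 1
  | 1 => X - C (a + (b - a) * (chainCoeff p 0 + chainCoeff p 1))
  | k + 2 =>
      (X - C (a + (b - a) * (chainCoeff p (2 * (k + 1)) + chainCoeff p (2 * (k + 1) + 1)))) *
          orthPoly a b p (k + 1)
        - C ((b - a) ^ 2 * (chainCoeff p (2 * (k + 1) - 1) * chainCoeff p (2 * (k + 1)))) *
          orthPoly a b p k

/-- The monic orthogonal polynomials with respect to the weight `x - a`. -/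
noncomputable def orthPolyLeft (a b : ℝ) (p : ℕ → ℝ) : ℕ → ℝ[X]
  | 0 => 1
  | k + 1 => orthPoly a b p (k + 1) +
      C (-((b - a) * chainCoeff p (2 * k + 2))) * orthPolyLeft a b p k

/-- The monic orthogonal polynomials with respect to the weight `b - x`. -/
noncomputable def orthPolyRight (a b : ℝ) (p : ℕ → ℝ) : ℕ → ℝ[X]
  | 0 => 1
  | k + 1 => orthPoly a b p (k + 1) +
      C ((b - a) * (p (2 * k + 1) * p (2 * k + 2))) * orthPolyRight a b p k

/-- The monic orthogonal polynomials with respect to the weight `(x - a) (b - x)`. -/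
noncomputable def orthPolyBoth (a b : ℝ) (p : ℕ → ℝ) : ℕ → ℝ[X]
  | 0 => 1
  | k + 1 => orthPolyLeft a b p (k + 1) +
      C ((b - a) * (p (2 * k + 2) * p (2 * k + 3))) * orthPolyBoth a b p k

variable {a b : ℝ} {p p' : ℕ → ℝ}

theorem zeta_eq_chainCoeff {N : ℕ} (p : Fin N → ℝ) (k : ℕ) :
    zeta p k = chainCoeff (entry p) k := by
  cases k <;> rfl

theorem Pstar_eq_orthPoly {N : ℕ} (p : Fin N → ℝ) :
    ∀ k, Pstar a b p k = orthPoly a b (entry p) k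
  | 0 => rfl
  | 1 => by simp only [Pstar, orthPoly, zeta_eq_chainCoeff]
  | k + 2 => by
      simp only [Pstar, orthPoly, zeta_eq_chainCoeff, Pstar_eq_orthPoly p k,
        Pstar_eq_orthPoly p (k + 1)]

/-- Together with the definition of `orthPolyLeft` this splits the three-term recursion into two
two-term ones: the recursion coefficients are sums and products of consecutive `(b - a) ζ`'s. -/
theorem mul_orthPolyLeft (h0 : p 0 = 0) : ∀ k, (X - C a) * orthPolyLeft a b p k =
    C 1 * orthPoly a b p (k + 1) + C ((b - a) * chainCoeff p (2 * k + 1)) * orthPoly a b p k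
  | 0 => by
      simp only [orthPolyLeft, orthPoly, chainCoeff, h0]
      simp only [map_add, map_mul, map_sub, map_one, map_zero]
      ring
  | k + 1 => by
      have ih := mul_orthPolyLeft h0 k
      rw [orthPolyLeft, mul_add, mul_left_comm, ih, orthPoly,
        show 2 * (k + 1) - 1 = 2 * k + 1 by omega]
      simp only [show 2 * (k + 1) = 2 * k + 2 by ring]
      simp only [map_add, map_mul, map_sub, map_one, map_neg, map_pow]
      ring

/-- The same splitting seen from `b`. It works because `p_{2k-1} p_{2k} + (1 - p_{2k})(1 -
p_{2k+1})` complements `ζ_{2k} + ζ_{2k+1}` to `1`, while the product of `(1 - p_{2k})(1 - p_{2k+1})`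
and `p_{2k+1} p_{2k+2}` is `ζ_{2k+1} ζ_{2k+2}`. -/
theorem mul_orthPolyRight (h0 : p 0 = 0) : ∀ k, (C b - X) * orthPolyRight a b p k =
    C (-1) * orthPoly a b p (k + 1) +
      C ((b - a) * ((1 - p (2 * k)) * (1 - p (2 * k + 1)))) * orthPoly a b p k
  | 0 => by
      simp only [orthPolyRight, orthPoly, chainCoeff, h0, mul_zero]
      simp only [map_add, map_mul, map_sub, map_one, map_zero, map_neg]
      ring
  | k + 1 => by
      have ih := mul_orthPolyRight h0 k
      rw [orthPolyRight, mul_add, mul_left_comm, ih, orthPoly,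
        show 2 * (k + 1) - 1 = 2 * k + 1 by omega]
      simp only [show 2 * (k + 1) = 2 * k + 1 + 1 by ring,
        chainCoeff]
      simp only [map_add, map_mul, map_sub, map_one, map_neg, map_pow]
      ring

theorem mul_orthPolyBoth (h0 : p 0 = 0) : ∀ k, (C b - X) * orthPolyBoth a b p k =
    C (-1) * orthPolyLeft a b p (k + 1) +
      C ((b - a) * ((1 - p (2 * k + 1)) * (1 - p (2 * k + 2)))) * orthPolyLeft a b p k
  | 0 => by
      simp only [orthPolyBoth, orthPolyLeft, orthPoly, chainCoeff, h0, mul_zero]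
      simp only [map_add, map_mul, map_sub, map_one, map_zero, map_neg]
      ring
  | k + 1 => by
      have ih := mul_orthPolyBoth h0 k
      have h1 := mul_orthPolyLeft (a := a) (b := b) h0 (k + 1)
      have e : orthPolyLeft a b p (k + 1) = orthPoly a b p (k + 1) +
        C (-((b - a) * chainCoeff p (2 * k + 2))) * orthPolyLeft a b p k := rfl
      rw [orthPolyBoth, mul_add, mul_left_comm, ih]
      have e2 : orthPolyLeft a b p (k + 1 + 1) = orthPoly a b p (k + 1 + 1) +
        C (-((b - a) * chainCoeff p (2 * (k + 1) + 2))) * orthPolyLeft a b p (k + 1) := rfl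
      rw [e2]
      -- `e3` and `e4` eliminate `orthPoly`, leaving a three-term recursion for `orthPolyLeft`
      -- alone.
      have e3 : orthPoly a b p (k + 1) = orthPolyLeft a b p (k + 1) +
        C ((b - a) * chainCoeff p (2 * k + 2)) * orthPolyLeft a b p k := by
        rw [e]; simp only [map_neg]; ring
      have e4 : orthPoly a b p (k + 1 + 1) = (X - C a) * orthPolyLeft a b p (k + 1) -
        C ((b - a) * chainCoeff p (2 * (k + 1) + 1)) * orthPoly a b p (k + 1) := by
        rw [h1]; simp only [map_one]; ring
      rw [e4, e3]
      simp only [show 2 * (k + 1) = 2 * k + 1 + 1 by ring, chainCoeff]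
      simp only [map_mul, map_sub, map_one, map_neg]
      ring

theorem chainCoeff_congr {k : ℕ} (h : ∀ i ≤ k, p i = p' i) :
    chainCoeff p k = chainCoeff p' k := by
  cases k with
  | zero => rfl
  | succ k => simp only [chainCoeff, h k (by omega), h (k + 1) le_rfl]

/-- The exact index ranges in this and the next three lemmas ensure that the polynomials testing the
moment of order `k + 1` do not involve `p (k + 1)`. -/
theorem orthPoly_congr : ∀ {k : ℕ}, (∀ i < 2 * k, p i = p' i) →
    orthPoly a b p k = orthPoly a b p' k
  | 0, _ => rfl
  | 1, h => by
      simp only [orthPoly, chainCoeff_congr (k := 1) (fun i hi => h i (by omega)),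
        chainCoeff_congr (k := 0) (fun i hi => h i (by omega))]
  | k + 2, h => by
      simp only [orthPoly, orthPoly_congr (k := k) (fun i hi => h i (by omega)),
        orthPoly_congr (k := k + 1) (fun i hi => h i (by omega)),
        chainCoeff_congr (k := 2 * (k + 1)) (fun i hi => h i (by omega)),
        chainCoeff_congr (k := 2 * (k + 1) + 1) (fun i hi => h i (by omega)),
        chainCoeff_congr (k := 2 * (k + 1) - 1) (fun i hi => h i (by omega))]

theorem orthPolyLeft_congr {k : ℕ} (h : ∀ i ≤ 2 * k, p i = p' i) :
    orthPolyLeft a b p k = orthPolyLeft a b p' k := by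
  induction k with
  | zero => rfl
  | succ k ih =>
    simp only [orthPolyLeft, ih (fun i hi => h i (by omega)),
      orthPoly_congr (k := k + 1) (fun i hi => h i (by omega)),
      chainCoeff_congr (k := 2 * k + 2) (fun i hi => h i (by omega))]

theorem orthPolyRight_congr {k : ℕ} (h : ∀ i ≤ 2 * k, p i = p' i) :
    orthPolyRight a b p k = orthPolyRight a b p' k := by
  induction k with
  | zero => rfl
  | succ k ih =>
    simp only [orthPolyRight, ih (fun i hi => h i (by omega)),
      orthPoly_congr (k := k + 1) (fun i hi => h i (by omega)),
      h (2 * k + 1) (by omega), h (2 * k + 2) (by omega)]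

theorem orthPolyBoth_congr {k : ℕ} (h : ∀ i ≤ 2 * k + 1, p i = p' i) :
    orthPolyBoth a b p k = orthPolyBoth a b p' k := by
  induction k with
  | zero => rfl
  | succ k ih =>
    simp only [orthPolyBoth, ih (fun i hi => h i (by omega)),
      orthPolyLeft_congr (k := k + 1) (fun i hi => h i (by omega)),
      h (2 * k + 3) (by omega), h (2 * k + 2) (by omega)]

theorem monic_add_of_natDegree_lt {f g : ℝ[X]} {k : ℕ} (hf : f.Monic ∧ f.natDegree = k + 1)
    (c : ℝ) (hg : g.Monic ∧ g.natDegree = k) :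
    (f + C c * g).Monic ∧ (f + C c * g).natDegree = k + 1 := by
  have hd : (C c * g).degree < f.degree := by
    refine lt_of_le_of_lt (C_mul' c g ▸ degree_smul_le c g) ?_
    rw [degree_eq_natDegree hf.1.ne_zero, degree_eq_natDegree hg.1.ne_zero, hf.2, hg.2]
    exact_mod_cast Nat.lt_succ_self k
  refine ⟨hf.1.add_of_left hd, ?_⟩
  rw [natDegree_eq_of_degree_eq (degree_add_eq_left_of_degree_lt hd), hf.2]

theorem orthPoly_monic : ∀ k, (orthPoly a b p k).Monic ∧ (orthPoly a b p k).natDegree = k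
  | 0 => ⟨monic_one, natDegree_one⟩
  | 1 => ⟨monic_X_sub_C _, natDegree_X_sub_C _⟩
  | k + 2 => by
      have h1 := orthPoly_monic (k + 1)
      have h2 := orthPoly_monic k
      have h3 : ∀ t : ℝ, ((X - C t) * orthPoly a b p (k + 1)).Monic ∧
          ((X - C t) * orthPoly a b p (k + 1)).natDegree = k + 2 := fun t =>
        ⟨(monic_X_sub_C t).mul h1.1, by
          rw [(monic_X_sub_C t).natDegree_mul h1.1, natDegree_X_sub_C, h1.2]; ring⟩
      rw [orthPoly]
      set s := (b - a) ^ 2 * (chainCoeff p (2 * (k + 1) - 1) * chainCoeff p (2 * (k + 1)))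
      set t := a + (b - a) * (chainCoeff p (2 * (k + 1)) + chainCoeff p (2 * (k + 1) + 1))
      have hd : (C s * orthPoly a b p k).degree < ((X - C t) * orthPoly a b p (k + 1)).degree := by
        refine lt_of_le_of_lt (C_mul' s (orthPoly a b p k) ▸ degree_smul_le s _) ?_
        rw [degree_eq_natDegree (h3 t).1.ne_zero, degree_eq_natDegree h2.1.ne_zero, (h3 t).2, h2.2]
        exact_mod_cast (by omega)
      refine ⟨(h3 t).1.sub_of_left hd, ?_⟩
      rw [natDegree_eq_of_degree_eq (degree_sub_eq_left_of_degree_lt hd), (h3 t).2]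

theorem orthPolyLeft_monic (k : ℕ) :
    (orthPolyLeft a b p k).Monic ∧ (orthPolyLeft a b p k).natDegree = k := by
  induction k with
  | zero => exact ⟨monic_one, natDegree_one⟩
  | succ k ih => exact monic_add_of_natDegree_lt (orthPoly_monic (k + 1)) _ ih

theorem orthPolyRight_monic (k : ℕ) :
    (orthPolyRight a b p k).Monic ∧ (orthPolyRight a b p k).natDegree = k := by
  induction k with
  | zero => exact ⟨monic_one, natDegree_one⟩
  | succ k ih => exact monic_add_of_natDegree_lt (orthPoly_monic (k + 1)) _ ih

theorem orthPolyBoth_monic (k : ℕ) :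
    (orthPolyBoth a b p k).Monic ∧ (orthPolyBoth a b p k).natDegree = k := by
  induction k with
  | zero => exact ⟨monic_one, natDegree_one⟩
  | succ k ih => exact monic_add_of_natDegree_lt (orthPolyLeft_monic (k + 1)) _ ih

/-! ### Location of the roots. -/

/-- A sequence of numbers in `[0,1]` that starts with `p₀ = 0`. -/
def IsUnitSeq (p : ℕ → ℝ) : Prop := p 0 = 0 ∧ ∀ k, p k ∈ Icc (0 : ℝ) 1

theorem IsUnitSeq.chainCoeff_nonneg (hp : IsUnitSeq p) (k : ℕ) : 0 ≤ chainCoeff p k := by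
  cases k with
  | zero => exact le_rfl
  | succ k => exact mul_nonneg (sub_nonneg.2 (hp.2 k).2) (hp.2 (k + 1)).1

/-- Left of `a`, both `orthPoly` and `orthPolyLeft` have the strict sign `(-1) ^ k`: the two-term
relations propagate it jointly, since every `ζ` is nonnegative and `x - a < 0`. -/
theorem orthPoly_eval_ne_zero_of_lt (hab : a < b) (hp : IsUnitSeq p) {x : ℝ} (hx : x < a) (k : ℕ) :
    (orthPoly a b p k).eval x ≠ 0 := by
  suffices h : 0 < (-1) ^ k * (orthPoly a b p k).eval x ∧
      0 < (-1) ^ k * (orthPolyLeft a b p k).eval x from fun h0 => by simp [h0] at h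
  induction k with
  | zero => simp [orthPoly, orthPolyLeft]
  | succ k ih =>
    have h1 := congrArg (eval x) (mul_orthPolyLeft (a := a) (b := b) hp.1 k)
    simp only [eval_mul, eval_add, eval_sub, eval_X, eval_C, one_mul] at h1
    have h2 : 0 ≤ (b - a) * chainCoeff p (2 * k + 1) :=
      mul_nonneg (by linarith) (hp.chainCoeff_nonneg _)
    have h3 : 0 ≤ (b - a) * chainCoeff p (2 * k + 2) :=
      mul_nonneg (by linarith) (hp.chainCoeff_nonneg _)
    have h4 : 0 < (-1) ^ (k + 1) * (orthPoly a b p (k + 1)).eval x := by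
      have := mul_pos (sub_pos.2 hx) ih.2
      have := mul_nonneg h2 ih.1.le
      rw [pow_succ, show (orthPoly a b p (k + 1)).eval x = (x - a) * (orthPolyLeft a b p k).eval x
        - (b - a) * chainCoeff p (2 * k + 1) * (orthPoly a b p k).eval x by linarith]
      linarith
    refine ⟨h4, ?_⟩
    have := mul_nonneg h3 ih.2.le
    simp only [orthPolyLeft, eval_add, eval_mul, eval_C]
    rw [pow_succ] at h4 ⊢
    linarith

theorem orthPoly_eval_ne_zero_of_gt (hab : a < b) (hp : IsUnitSeq p) {x : ℝ} (hx : b < x) (k : ℕ) :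
    (orthPoly a b p k).eval x ≠ 0 := by
  suffices h : 0 < (orthPoly a b p k).eval x ∧ 0 < (orthPolyRight a b p k).eval x from h.1.ne'
  induction k with
  | zero => simp [orthPoly, orthPolyRight]
  | succ k ih =>
    have h1 := congrArg (eval x) (mul_orthPolyRight (a := a) (b := b) hp.1 k)
    simp only [eval_mul, eval_add, eval_sub, eval_X, eval_C] at h1
    have hl : 0 ≤ b - a := by linarith
    have h2 : 0 ≤ (b - a) * ((1 - p (2 * k)) * (1 - p (2 * k + 1))) :=
      mul_nonneg hl (mul_nonneg (sub_nonneg.2 (hp.2 _).2) (sub_nonneg.2 (hp.2 _).2))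
    have h3 : 0 ≤ (b - a) * (p (2 * k + 1) * p (2 * k + 2)) :=
      mul_nonneg hl (mul_nonneg (hp.2 _).1 (hp.2 _).1)
    have h4 : 0 < (orthPoly a b p (k + 1)).eval x := by
      have := mul_pos (sub_pos.2 hx) ih.2
      have := mul_nonneg h2 ih.1.le
      linarith
    refine ⟨h4, ?_⟩
    have := mul_nonneg h3 ih.2.le
    simp only [orthPolyRight, eval_add, eval_mul, eval_C]
    linarith

/-! ### Transfer of orthogonality to a weighted functional. -/

/-- Passing from a family that is orthogonal with respect to `L` to a family that is orthogonal
with respect to the weighted functional `L (y * ·)`. -/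
theorem orthogonal_of_recurrence (L : ℝ[X] →ₗ[ℝ] ℝ) (A B : ℕ → ℝ[X]) (y : ℝ[X]) (s r : ℕ → ℝ)
    (e : ℝ) (N : ℕ) (hB0 : B 0 = A 0) (hB : ∀ k, B (k + 1) = A (k + 1) + C (s k) * B k)
    (hy : ∀ k, y * B k = C e * A (k + 1) + C (r k) * A k)
    (hA : ∀ i j, i ≤ N → j ≤ N → i ≠ j → L (A i * A j) = 0) (i j : ℕ) (hi : i < N) (hj : j < N) :
    L (y * (B i * B j)) = if i = j then r i * L (A i * A i) else 0 := by
  -- `y * B i` lies in the span of `A i` and `A (i + 1)`, so it sees `A j` with `j ≤ i` only when `j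
  -- = i`; `key2` then turns `A j` into `B j` by induction.
  have key : ∀ i j, i < N → j ≤ i →
      L (y * (B i * A j)) = if i = j then r i * L (A i * A i) else 0 := by
    intro i j hi hj
    have : y * (B i * A j) = e • (A (i + 1) * A j) + r i • (A i * A j) := by
      rw [← mul_assoc, hy]; simp only [smul_eq_C_mul]; ring
    rw [this, map_add, map_smul, map_smul, hA _ _ (by omega) (by omega) (by omega)]
    split_ifs with h
    · subst h; simp
    · simp [hA i j (by omega) (by omega) h]
  have key2 : ∀ i j, i < N → j ≤ i →
      L (y * (B i * B j)) = if i = j then r i * L (A i * A i) else 0 := by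
    intro i j hi hj
    induction j with
    | zero => rw [hB0, key i 0 hi hj]
    | succ j ih =>
      have : y * (B i * B (j + 1)) = y * (B i * A (j + 1)) + s j • (y * (B i * B j)) := by
        rw [hB]; simp only [smul_eq_C_mul]; ring
      rw [this, map_add, map_smul, ih (by omega), key i (j + 1) hi hj, if_neg (by omega : i ≠ j)]
      simp
  rcases le_total j i with h | h
  · exact key2 i j hi h
  · rw [mul_comm (B i), key2 j i hj h]
    by_cases hij : i = j
    · subst hij; rfl
    · rw [if_neg hij, if_neg (Ne.symm hij)]

/-! ### Tridiagonal determinants. -/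

section Tridiagonal

variable {R : Type*} [CommRing R]

/-- The tridiagonal matrix with diagonal `d`, superdiagonal `u` and subdiagonal `l`. -/
def tridiagonal (N : ℕ) (d u l : ℕ → R) : Matrix (Fin N) (Fin N) R :=
  Matrix.of fun i j => if (i : ℕ) = j then d i else if (i : ℕ) + 1 = j then u i else
    if (j : ℕ) + 1 = i then l j else 0

theorem det_tridiagonal_add_two (N : ℕ) (d u l : ℕ → R) :
    (tridiagonal (N + 2) d u l).det = d (N + 1) * (tridiagonal (N + 1) d u l).det
      - u N * l N * (tridiagonal N d u l).det := by
  have hlast : (tridiagonal (N + 2) d u l).submatrix (Fin.last (N + 1)).succAbove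
      (Fin.last (N + 1)).succAbove = tridiagonal (N + 1) d u l := by
    ext i j; simp [tridiagonal]
  -- The last column of this minor has `u N` as its only possibly nonzero entry, so one more
  -- expansion finishes.
  have hminor : ((tridiagonal (N + 2) d u l).submatrix (Fin.last (N + 1)).succAbove
      (Fin.last N).castSucc.succAbove).det = u N * (tridiagonal N d u l).det := by
    rw [Matrix.det_succ_column _ (Fin.last N), Finset.sum_eq_single (Fin.last N)]
    · have h1 : ((-1 : R)) ^ (((Fin.last N : Fin (N + 1)) : ℕ) + ((Fin.last N : Fin (N + 1)) : ℕ))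
          = 1 := by rw [← two_mul, pow_mul]; simp
      rw [h1, one_mul]
      congr 1
      · simp [tridiagonal]
      · congr 1
        ext i j
        have : (Fin.last N).castSucc.succAbove j.castSucc = j.castSucc.castSucc := by
          rw [Fin.succAbove_of_castSucc_lt]
          simp [Fin.lt_def]
        simp [tridiagonal, this]
    · intro i _ hi
      have hi' : (i : ℕ) < N := lt_of_le_of_ne (by omega) fun h => hi (Fin.ext h)
      have h2 : tridiagonal (N + 2) d u l i.castSucc (Fin.last (N + 1)) = 0 := by
        simp only [tridiagonal, Matrix.of_apply, Fin.val_castSucc, Fin.val_last]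
        rw [if_neg (by omega), if_neg (by omega), if_neg (by omega)]
      simp [h2]
    · simp
  rw [Matrix.det_succ_row _ (Fin.last (N + 1)), Fin.sum_univ_castSucc,
    Finset.sum_eq_single (Fin.last N), hlast, hminor]
  · have h1 : ((-1 : R)) ^ (((Fin.last (N + 1) : Fin (N + 2)) : ℕ) +
        ((Fin.last (N + 1) : Fin (N + 2)) : ℕ)) = 1 := by rw [← two_mul, pow_mul]; simp
    have h2 : ((-1 : R)) ^ (((Fin.last (N + 1) : Fin (N + 2)) : ℕ) +
        (((Fin.last N).castSucc : Fin (N + 2)) : ℕ)) = -1 := by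
      simp only [Fin.val_last, Fin.val_castSucc]
      rw [show N + 1 + N = 2 * N + 1 by ring, pow_succ, pow_mul]; simp
    have h3 : tridiagonal (N + 2) d u l (Fin.last (N + 1)) (Fin.last (N + 1)) = d (N + 1) := by
      simp [tridiagonal]
    have h4 : tridiagonal (N + 2) d u l (Fin.last (N + 1)) (Fin.last N).castSucc = l N := by
      simp only [tridiagonal, Matrix.of_apply, Fin.val_castSucc, Fin.val_last]
      rw [if_neg (by omega), if_neg (by omega), if_pos trivial]
    rw [h1, h2, h3, h4]; ring
  · intro j _ hj
    have hj' : (j : ℕ) < N := lt_of_le_of_ne (by omega) fun h => hj (Fin.ext h)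
    have h2 : tridiagonal (N + 2) d u l (Fin.last (N + 1)) j.castSucc = 0 := by
      simp only [tridiagonal, Matrix.of_apply, Fin.val_castSucc, Fin.val_last]
      rw [if_neg (by omega), if_neg (by omega), if_neg (by omega)]
    simp [h2]
  · simp

theorem charmatrix_tridiagonal (N : ℕ) (d u l : ℕ → R) :
    (tridiagonal N d u l).charmatrix =
      tridiagonal N (fun i => X - C (d i)) (fun i => -C (u i)) (fun i => -C (l i)) := by
  ext1 i j
  rw [Matrix.charmatrix_apply, Matrix.diagonal_apply]
  simp only [tridiagonal, Matrix.of_apply, Fin.ext_iff]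
  split_ifs <;> simp

end Tridiagonal

/-! ### Spectral measure of the Jacobi matrix. -/

theorem aeval_diagonal {ι : Type*} [Fintype ι] [DecidableEq ι] (v : ι → ℝ) (f : ℝ[X]) :
    aeval (Matrix.diagonal v) f = Matrix.diagonal fun i => f.eval (v i) := by
  induction f using Polynomial.induction_on' with
  | add f g hf hg => simp [hf, hg]
  | monomial k r =>
    rw [aeval_monomial, Matrix.diagonal_pow, ← Algebra.smul_def, ← Matrix.diagonal_smul]
    congr 1
    ext i
    simp

theorem aeval_transpose {ι : Type*} [Fintype ι] [DecidableEq ι] (A : Matrix ι ι ℝ) (f : ℝ[X]) :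
    (aeval A f).transpose = aeval A.transpose f := by
  induction f using Polynomial.induction_on' with
  | add f g hf hg => simp [hf, hg]
  | monomial k r =>
    rw [aeval_monomial, aeval_monomial, ← Algebra.smul_def, ← Algebra.smul_def,
      Matrix.transpose_smul, Matrix.transpose_pow]

/-- The spectral measure of a symmetric matrix at a basis vector. -/
theorem exists_spectralWeights {N : ℕ} (A : Matrix (Fin N) (Fin N) ℝ) (hA : A.IsHermitian)
    (i₀ : Fin N) : ∃ w : Fin N → NNReal, ∀ f : ℝ[X],
      ∑ i, (w i : ℝ) * f.eval (hA.eigenvalues i) = (aeval A f) i₀ i₀ := by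
  -- The weights are the squared `i₀`-coordinates of an orthonormal eigenbasis.
  refine ⟨fun i => Real.toNNReal ((hA.eigenvectorBasis i i₀) ^ 2), fun f => ?_⟩
  have h := hA.spectral_theorem
  have h2 : aeval A f = Unitary.conjStarAlgAut ℝ _ hA.eigenvectorUnitary
      (Matrix.diagonal fun i => f.eval (hA.eigenvalues i)) := by
    conv_lhs => rw [h]
    rw [aeval_algHom_apply (Unitary.conjStarAlgAut ℝ _ hA.eigenvectorUnitary : _ ≃⋆ₐ[ℝ] _),
      aeval_diagonal]
    rfl
  rw [h2, Unitary.conjStarAlgAut_apply, Matrix.mul_apply]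
  refine Finset.sum_congr rfl fun i _ => ?_
  rw [Real.coe_toNNReal _ (sq_nonneg _)]
  simp [Matrix.mul_diagonal]
  ring

/-- The off-diagonal entries of the Jacobi matrix. -/
noncomputable def jacobiOff (a b : ℝ) (p : ℕ → ℝ) (k : ℕ) : ℝ :=
  (b - a) * √(chainCoeff p (2 * k + 1) * chainCoeff p (2 * k + 2))

/-- The Jacobi matrix with characteristic polynomial `orthPoly a b p N`. -/
noncomputable def jacobi (a b : ℝ) (p : ℕ → ℝ) (N : ℕ) : Matrix (Fin N) (Fin N) ℝ :=
  tridiagonal N (fun k => a + (b - a) * (chainCoeff p (2 * k) + chainCoeff p (2 * k + 1)))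
    (jacobiOff a b p) (jacobiOff a b p)

theorem jacobi_transpose (N : ℕ) : (jacobi a b p N).transpose = jacobi a b p N := by
  ext i j
  simp only [jacobi, tridiagonal, Matrix.transpose_apply, Matrix.of_apply]
  split_ifs <;> first | rfl | omega | simp_all

theorem jacobi_isHermitian (N : ℕ) : (jacobi a b p N).IsHermitian := by
  rw [Matrix.IsHermitian, Matrix.conjTranspose_eq_transpose_of_trivial, jacobi_transpose]

theorem jacobiOff_sq (hp : IsUnitSeq p) (k : ℕ) : jacobiOff a b p k ^ 2 =
    (b - a) ^ 2 * (chainCoeff p (2 * k + 1) * chainCoeff p (2 * k + 2)) := by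
  rw [jacobiOff, mul_pow, Real.sq_sqrt (mul_nonneg (hp.chainCoeff_nonneg _)
    (hp.chainCoeff_nonneg _))]

theorem orthPoly_add_two (hp : IsUnitSeq p) (k : ℕ) : orthPoly a b p (k + 2) =
    (X - C (a + (b - a) * (chainCoeff p (2 * (k + 1)) + chainCoeff p (2 * (k + 1) + 1)))) *
      orthPoly a b p (k + 1) - C (jacobiOff a b p k) * C (jacobiOff a b p k) *
        orthPoly a b p k := by
  rw [← C_mul, ← sq, jacobiOff_sq hp]
  rfl

/-- The determinant recursion uses only the squares of the off-diagonal entries, and these are the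
coefficients `(b - a)² ζ ζ` of the three-term recursion. -/
theorem charpoly_jacobi (hp : IsUnitSeq p) : ∀ N, (jacobi a b p N).charpoly = orthPoly a b p N
  | 0 => by simp [orthPoly]
  | 1 => by
      simp [Matrix.charpoly, jacobi, orthPoly, Matrix.det_unique, tridiagonal]
  | N + 2 => by
      rw [orthPoly_add_two hp, ← charpoly_jacobi hp N, ← charpoly_jacobi hp (N + 1)]
      simp only [Matrix.charpoly, jacobi, charmatrix_tridiagonal, det_tridiagonal_add_two]
      ring

/-- The `k`-th standard basis vector, zero for `k` out of range. -/
def stdVec (N k : ℕ) : Fin N → ℝ := fun i => if (i : ℕ) = k then 1 else 0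

theorem mulVec_stdVec {N : ℕ} (A : Matrix (Fin N) (Fin N) ℝ) {k : ℕ} (hk : k < N) (i : Fin N) :
    A.mulVec (stdVec N k) i = A i ⟨k, hk⟩ := by
  rw [Matrix.mulVec, dotProduct, Finset.sum_eq_single ⟨k, hk⟩]
  · simp [stdVec]
  · intro j _ hj
    have : (j : ℕ) ≠ k := fun h => hj (Fin.ext h)
    simp [stdVec, this]
  · simp

theorem jacobi_mulVec_zero {N : ℕ} (hN : 0 < N) :
    (jacobi a b p N).mulVec (stdVec N 0) =
      (a + (b - a) * (chainCoeff p 0 + chainCoeff p 1)) • stdVec N 0 +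
        jacobiOff a b p 0 • stdVec N 1 := by
  ext i
  rw [mulVec_stdVec _ hN]
  simp only [jacobi, tridiagonal, Matrix.of_apply, stdVec, Pi.add_apply, Pi.smul_apply,
    smul_eq_mul]
  split_ifs <;> first | omega | simp_all

theorem jacobi_mulVec_succ {N k : ℕ} (hN : k + 1 < N) :
    (jacobi a b p N).mulVec (stdVec N (k + 1)) =
      jacobiOff a b p k • stdVec N k +
      (a + (b - a) * (chainCoeff p (2 * (k + 1)) + chainCoeff p (2 * (k + 1) + 1))) •
        stdVec N (k + 1) + jacobiOff a b p (k + 1) • stdVec N (k + 2) := by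
  ext i
  rw [mulVec_stdVec _ hN]
  simp only [jacobi, tridiagonal, Matrix.of_apply, stdVec, Pi.add_apply, Pi.smul_apply,
    smul_eq_mul]
  obtain ⟨m, hm⟩ := i
  by_cases h1 : m = k
  · subst h1; simp
  · by_cases h2 : m = k + 1
    · subst h2; simp
    · by_cases h3 : m = k + 2
      · subst h3; simp
      · simp [h1, h2, h3, Ne.symm h3]

/-- The three-term recursion is the action of the matrix on basis vectors, up to scaling by
off-diagonal products. At `k = N` the right side vanishes, as Cayley–Hamilton demands. -/
theorem aeval_jacobi_mulVec (hp : IsUnitSeq p) {N : ℕ} (hN : 0 < N) : ∀ {k : ℕ}, k ≤ N →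
    (aeval (jacobi a b p N) (orthPoly a b p k)).mulVec (stdVec N 0) =
      (∏ i ∈ Finset.range k, jacobiOff a b p i) • stdVec N k
  | 0, _ => by simp [orthPoly]
  | 1, _ => by
      simp only [orthPoly, map_sub, aeval_X, aeval_C, Matrix.sub_mulVec, jacobi_mulVec_zero hN,
        Algebra.algebraMap_eq_smul_one, Matrix.smul_mulVec, Matrix.one_mulVec]
      simp
  | k + 2, h => by
      have h1 := aeval_jacobi_mulVec hp hN (k := k + 1) (by omega)
      have h2 := aeval_jacobi_mulVec hp hN (k := k) (by omega)
      rw [orthPoly_add_two hp, ← C_mul]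
      simp only [map_sub, map_mul, aeval_X, aeval_C, Matrix.sub_mulVec, ← Matrix.mulVec_mulVec,
        h1, h2, Algebra.algebraMap_eq_smul_one, Matrix.smul_mulVec, Matrix.one_mulVec,
        Matrix.mulVec_smul, jacobi_mulVec_succ (show k + 1 < N by omega), smul_smul,
        Finset.prod_range_succ]
      ext i
      simp only [Pi.sub_apply, Pi.add_apply, Pi.smul_apply, smul_eq_mul]
      ring

/-- By symmetry of the matrix the corner entry is the inner product of the two vectors `P(A) e₀`,
whence orthogonality. -/
theorem aeval_jacobi_mul (hp : IsUnitSeq p) {N : ℕ} (hN : 0 < N) {i j : ℕ} (hi : i ≤ N)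
    (hj : j ≤ N) :
    aeval (jacobi a b p N) (orthPoly a b p i * orthPoly a b p j) ⟨0, hN⟩ ⟨0, hN⟩ =
      (∏ i ∈ Finset.range i, jacobiOff a b p i) * (∏ i ∈ Finset.range j, jacobiOff a b p i) *
        (stdVec N i ⬝ᵥ stdVec N j) := by
  have key : ∀ {k : ℕ}, k ≤ N → ∀ l, (aeval (jacobi a b p N) (orthPoly a b p k)) l ⟨0, hN⟩ =
      (∏ i ∈ Finset.range k, jacobiOff a b p i) * stdVec N k l := by
    intro k hk l
    rw [← mulVec_stdVec (aeval (jacobi a b p N) (orthPoly a b p k)) hN,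
      aeval_jacobi_mulVec hp hN hk]
    rfl
  rw [map_mul, Matrix.mul_apply, dotProduct, Finset.mul_sum]
  refine Finset.sum_congr rfl fun l _ => ?_
  rw [key hj, ← Matrix.transpose_apply (aeval (jacobi a b p N) (orthPoly a b p i)),
    aeval_transpose, jacobi_transpose, key hi]
  ring

/-! ### Integration of polynomials and realisation of a given sequence. -/

variable {μ ν : Measure ℝ} {n : ℕ}

theorem ae_mem_Icc (hμ : μ ∈ probOn a b) : ∀ᵐ x ∂μ, x ∈ Icc a b :=
  (mem_ae_iff (s := Icc a b)).2 hμ.2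

theorem integrable_of_continuous (hμ : μ ∈ probOn a b) {f : ℝ → ℝ} (hf : Continuous f) :
    Integrable f μ := by
  have := hμ.1
  have h := (hf.continuousOn (s := Icc a b)).integrableOn_compact (μ := μ) isCompact_Icc
  rwa [IntegrableOn, Measure.restrict_eq_self_of_ae_mem (ae_mem_Icc hμ)] at h

theorem integrable_eval (hμ : μ ∈ probOn a b) (f : ℝ[X]) : Integrable (fun x => f.eval x) μ :=
  integrable_of_continuous hμ f.continuous

/-- Integration of polynomials as a linear functional. -/
noncomputable def polyIntegral (hμ : μ ∈ probOn a b) : ℝ[X] →ₗ[ℝ] ℝ where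
  toFun f := ∫ x, f.eval x ∂μ
  map_add' f g := by
    simp only [eval_add]
    exact integral_add (integrable_eval hμ f) (integrable_eval hμ g)
  map_smul' r f := by
    simp only [eval_smul, RingHom.id_apply]
    exact integral_smul r _

theorem polyIntegral_apply (hμ : μ ∈ probOn a b) (f : ℝ[X]) :
    polyIntegral hμ f = ∫ x, f.eval x ∂μ := rfl

theorem polyIntegral_X_pow (hμ : μ ∈ probOn a b) (k : ℕ) :
    polyIntegral hμ (X ^ k) = ∫ x, x ^ k ∂μ := by
  simp [polyIntegral_apply]

theorem polyIntegral_nonneg (hμ : μ ∈ probOn a b) {f : ℝ[X]}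
    (hf : ∀ x ∈ Icc a b, 0 ≤ f.eval x) : 0 ≤ polyIntegral hμ f :=
  integral_nonneg_of_ae ((ae_mem_Icc hμ).mono hf)

/-- Measures with the same moments of order less than `k` integrate polynomials of degree less
than `k` in the same way. -/
theorem polyIntegral_congr (hμ : μ ∈ probOn a b) (hν : ν ∈ probOn a b) {k : ℕ}
    (h : ∀ i < k, ∫ x, x ^ i ∂μ = ∫ x, x ^ i ∂ν) {f : ℝ[X]} (hf : f.degree < k) :
    polyIntegral hμ f = polyIntegral hν f := by
  have hsum : ∀ {ρ : Measure ℝ} (hρ : ρ ∈ probOn a b),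
      polyIntegral hρ f = ∑ i ∈ f.support, f.coeff i * ∫ x, x ^ i ∂ρ := by
    intro ρ hρ
    conv_lhs => rw [f.as_sum_support_C_mul_X_pow]
    rw [map_sum]
    refine Finset.sum_congr rfl fun i _ => ?_
    rw [← smul_eq_C_mul, map_smul, polyIntegral_X_pow, smul_eq_mul]
  rw [hsum hμ, hsum hν]
  refine Finset.sum_congr rfl fun i hi => ?_
  rw [h i]
  have := (le_degree_of_mem_supp i hi).trans_lt hf
  exact_mod_cast this

/-- `μ` is a measure on `[a,b]` with orthogonal polynomials `orthPoly a b p k`, `k ≤ n + 1`. -/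
structure IsRepresentedBy (a b : ℝ) (n : ℕ) (p : ℕ → ℝ) (μ : Measure ℝ) : Prop where
  mem : μ ∈ probOn a b
  orth : ∀ i j, i ≤ n + 1 → j ≤ n + 1 → i ≠ j →
    polyIntegral mem (orthPoly a b p i * orthPoly a b p j) = 0
  norm : ∀ i, i ≤ n → polyIntegral mem (orthPoly a b p i * orthPoly a b p i) =
    ∏ m ∈ Finset.range (2 * i), ((b - a) * chainCoeff p (m + 1))

theorem orthPoly_root_mem_Icc (hab : a < b) (hp : IsUnitSeq p) {k : ℕ} {x : ℝ}
    (hx : (orthPoly a b p k).IsRoot x) : x ∈ Icc a b :=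
  ⟨not_lt.1 fun h => orthPoly_eval_ne_zero_of_lt hab hp h k hx,
    not_lt.1 fun h => orthPoly_eval_ne_zero_of_gt hab hp h k hx⟩

theorem card_roots_orthPoly (hp : IsUnitSeq p) (k : ℕ) :
    (orthPoly a b p k).roots.card = k := by
  rw [← charpoly_jacobi hp, (jacobi_isHermitian k).roots_charpoly_eq_eigenvalues]
  simp

theorem prod_jacobiOff_sq (hp : IsUnitSeq p) (k : ℕ) :
    (∏ i ∈ Finset.range k, jacobiOff a b p i) * (∏ i ∈ Finset.range k, jacobiOff a b p i) =
      ∏ m ∈ Finset.range (2 * k), ((b - a) * chainCoeff p (m + 1)) := by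
  induction k with
  | zero => simp
  | succ k ih =>
    have h := jacobiOff_sq (a := a) (b := b) hp k
    rw [show 2 * (k + 1) = 2 * k + 1 + 1 by ring, Finset.prod_range_succ, Finset.prod_range_succ,
      Finset.prod_range_succ, ← ih]
    linear_combination (∏ i ∈ Finset.range k, jacobiOff a b p i) ^ 2 * h

/-- Every sequence in `[0,1]` is realised by a measure that is carried by the roots of
`orthPoly a b p (n + 1)`. -/
theorem exists_isRepresentedBy (hab : a < b) (hp : IsUnitSeq p) (n : ℕ) :
    ∃ μ, IsRepresentedBy a b n p μ ∧
      (∃ (w : Fin (n + 1) → NNReal) (x : Fin (n + 1) → ℝ),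
        (∀ i, x i ∈ Icc a b) ∧ μ = ∑ i, w i • Measure.dirac (x i)) ∧
      μ {x | (orthPoly a b p (n + 1)).IsRoot x}ᶜ = 0 := by
  have hA := jacobi_isHermitian (a := a) (b := b) (p := p) (n + 1)
  obtain ⟨w, hw⟩ := exists_spectralWeights _ hA ⟨0, n.succ_pos⟩
  have hroot : ∀ i, (orthPoly a b p (n + 1)).IsRoot (hA.eigenvalues i) := by
    intro i
    rw [← charpoly_jacobi hp, hA.charpoly_eq, IsRoot, eval_prod]
    exact Finset.prod_eq_zero (Finset.mem_univ i) (by simp)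
  set μ : Measure ℝ := ∑ i, w i • Measure.dirac (hA.eigenvalues i) with hμ
  have hsum : ∑ i, (w i : ℝ) = 1 := by simpa using hw 1
  have hnull : ∀ s : Set ℝ, MeasurableSet s → (∀ i, hA.eigenvalues i ∉ s) → μ s = 0 := by
    intro s hs h
    rw [hμ, Measure.finsetSum_apply]
    refine Finset.sum_eq_zero fun i _ => ?_
    simp [Measure.smul_apply, Measure.dirac_apply' _ hs, h i]
  have hprob : μ ∈ probOn a b := by
    refine ⟨⟨?_⟩, hnull _ measurableSet_Icc.compl fun i h =>
      h (orthPoly_root_mem_Icc hab hp (hroot i))⟩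
    rw [hμ, Measure.finsetSum_apply]
    simp only [Measure.smul_apply, measure_univ]
    have : ∑ i, w i = 1 := by exact_mod_cast hsum
    simp only [ENNReal.smul_def, smul_eq_mul, mul_one]
    rw [← ENNReal.ofNNReal_finsetSum, this, ENNReal.coe_one]
  have hint : ∀ f : ℝ[X], polyIntegral hprob f = aeval (jacobi a b p (n + 1)) f
      ⟨0, n.succ_pos⟩ ⟨0, n.succ_pos⟩ := by
    intro f
    rw [← hw, polyIntegral_apply, hμ, integral_finsetSum_measure]
    · refine Finset.sum_congr rfl fun i _ => ?_
      rw [integral_smul_nnreal_measure, integral_dirac, NNReal.smul_def, smul_eq_mul]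
    · intro i _
      exact (integrable_dirac (by simp)).smul_measure_nnreal
  refine ⟨μ, ⟨hprob, fun i j hi hj hij => ?_, fun i hi => ?_⟩,
    ⟨w, hA.eigenvalues, fun i => orthPoly_root_mem_Icc hab hp (hroot i), rfl⟩, ?_⟩
  -- Index `n + 1` is allowed here because `stdVec (n + 1) (n + 1)` is zero; the norm formula below
  -- needs a genuine unit vector, hence `i ≤ n`.
  · rw [hint, aeval_jacobi_mul hp n.succ_pos hi hj]
    have : stdVec (n + 1) i ⬝ᵥ stdVec (n + 1) j = 0 := by
      refine Finset.sum_eq_zero fun l _ => ?_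
      simp only [stdVec]
      split_ifs <;> first | omega | simp
    rw [this, mul_zero]
  · rw [hint, aeval_jacobi_mul hp n.succ_pos (by omega) (by omega), prod_jacobiOff_sq hp]
    have : stdVec (n + 1) i ⬝ᵥ stdVec (n + 1) i = 1 := by
      rw [dotProduct, Finset.sum_eq_single ⟨i, by omega⟩]
      · simp [stdVec]
      · intro l _ hl
        have : (l : ℕ) ≠ i := fun h => hl (Fin.ext h)
        simp [stdVec, this]
      · simp
    rw [this, mul_one]
  · exact hnull _ (isClosed_eq (orthPoly a b p (n + 1)).continuous
      continuous_const).measurableSet.compl fun i h => h (hroot i)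

/-! ### The exact range of the next moment. -/

/-- The length of the range of the moment of order `k + 1`. -/
noncomputable def momentWidth (a b : ℝ) (p : ℕ → ℝ) (k : ℕ) : ℝ :=
  (b - a) ^ (k + 1) * ∏ i ∈ Finset.range k, (p (i + 1) * (1 - p (i + 1)))

theorem momentWidth_succ (k : ℕ) : momentWidth a b p (k + 1) =
    (b - a) * (p (k + 1) * (1 - p (k + 1))) * momentWidth a b p k := by
  rw [momentWidth, momentWidth, Finset.prod_range_succ]; ring

theorem momentWidth_congr {k : ℕ} (h : ∀ i ≤ k, p' i = p i) :
    momentWidth a b p' k = momentWidth a b p k := by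
  rw [momentWidth, momentWidth]
  congr 1
  refine Finset.prod_congr rfl fun i hi => ?_
  rw [h (i + 1) (Finset.mem_range.1 hi)]

theorem momentWidth_nonneg (hab : a < b) (hp : IsUnitSeq p) (k : ℕ) :
    0 ≤ momentWidth a b p k :=
  mul_nonneg (pow_nonneg (sub_pos.2 hab).le _) (Finset.prod_nonneg fun _ _ =>
    mul_nonneg (hp.2 _).1 (sub_nonneg.2 (hp.2 _).2))

theorem momentWidth_eq_zero_iff (hab : a < b) (k : ℕ) :
    momentWidth a b p k = 0 ↔ ∃ i, 1 ≤ i ∧ i ≤ k ∧ (p i = 0 ∨ p i = 1) := by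
  have : (b - a) ^ (k + 1) ≠ 0 := pow_ne_zero _ (sub_pos.2 hab).ne'
  rw [momentWidth, mul_eq_zero, or_iff_right this, Finset.prod_eq_zero_iff]
  constructor
  · rintro ⟨i, hi, h⟩
    refine ⟨i + 1, by omega, Finset.mem_range.1 hi, ?_⟩
    rcases mul_eq_zero.1 h with h | h
    · exact Or.inl h
    · exact Or.inr (by linarith)
  · rintro ⟨i, h1, h2, h⟩
    refine ⟨i - 1, Finset.mem_range.2 (by omega), ?_⟩
    rw [Nat.sub_add_cancel h1]
    rcases h with h | h <;> simp [h]

/-- Regrouping the factors `(1 - p_m) p_{m+1}` pairs `p_m` with `1 - p_m`; only the last `p` stays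
unpaired. -/
theorem prod_chainCoeff (hp : IsUnitSeq p) (k : ℕ) :
    ∏ m ∈ Finset.range (k + 1), ((b - a) * chainCoeff p (m + 1)) =
      momentWidth a b p k * p (k + 1) := by
  induction k with
  | zero => simp [momentWidth, chainCoeff, hp.1]
  | succ k ih => rw [Finset.prod_range_succ, ih, momentWidth_succ, chainCoeff]; ring

theorem prod_chainCoeff_mul (hp : IsUnitSeq p) (k : ℕ) :
    (b - a) * (1 - p k) * ∏ m ∈ Finset.range k, ((b - a) * chainCoeff p (m + 1)) =
      momentWidth a b p k := by
  cases k with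
  | zero => simp [momentWidth, hp.1]
  | succ k => rw [prod_chainCoeff hp, momentWidth_succ]; ring

theorem degree_sub_X_pow_lt_of_monic {f : ℝ[X]} (hf : f.Monic) {k : ℕ}
    (hk : f.natDegree = k) : (f - X ^ k).degree < (k : WithBot ℕ) := by
  have h1 : f.degree = k := by rw [degree_eq_natDegree hf.ne_zero, hk]
  have h2 := degree_sub_lt_left (p := f) (q := X ^ k) (by rw [h1, degree_X_pow]) hf.ne_zero
    (by rw [hf.leadingCoeff, leadingCoeff_X_pow])
  rwa [h1] at h2

theorem IsRepresentedBy.orthLeft (h : IsRepresentedBy a b n p μ) (hp : IsUnitSeq p) (i j : ℕ)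
    (hi : i < n + 1) (hj : j < n + 1) :
    polyIntegral h.mem ((X - C a) * (orthPolyLeft a b p i * orthPolyLeft a b p j)) =
      if i = j then momentWidth a b p (2 * i) * p (2 * i + 1) else 0 := by
  rw [orthogonal_of_recurrence (polyIntegral h.mem) (orthPoly a b p) (orthPolyLeft a b p) (X - C a)
    _ _ 1 (n + 1) rfl (fun k => rfl) (mul_orthPolyLeft hp.1) h.orth i j hi hj]
  split_ifs with hij
  · rw [h.norm i (by omega), ← prod_chainCoeff hp, Finset.prod_range_succ]; ring
  · rfl

theorem IsRepresentedBy.orthRight (h : IsRepresentedBy a b n p μ) (hp : IsUnitSeq p) (i : ℕ)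
    (hi : i < n + 1) :
    polyIntegral h.mem ((C b - X) * (orthPolyRight a b p i * orthPolyRight a b p i)) =
      momentWidth a b p (2 * i) * (1 - p (2 * i + 1)) := by
  rw [orthogonal_of_recurrence (polyIntegral h.mem) (orthPoly a b p) (orthPolyRight a b p)
    (C b - X) _ _ (-1) (n + 1) rfl (fun k => rfl) (mul_orthPolyRight hp.1) h.orth i i hi hi,
    if_pos rfl, h.norm i (by omega), ← prod_chainCoeff_mul hp]
  ring

theorem IsRepresentedBy.orthBoth (h : IsRepresentedBy a b n p μ) (hp : IsUnitSeq p) (i : ℕ)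
    (hi : i < n) :
    polyIntegral h.mem ((X - C a) * (C b - X) * (orthPolyBoth a b p i * orthPolyBoth a b p i)) =
      momentWidth a b p (2 * i + 1) * (1 - p (2 * i + 2)) := by
  -- A second transfer, now for the functional already weighted by `x - a`; each transfer lowers the
  -- admissible index by one.
  have := orthogonal_of_recurrence (polyIntegral h.mem ∘ₗ LinearMap.mulLeft ℝ (X - C a))
    (orthPolyLeft a b p) (orthPolyBoth a b p) (C b - X) _ _ (-1) n rfl (fun k => rfl)
    (mul_orthPolyBoth hp.1) (fun i j hi hj hij => by
      simpa [hij] using h.orthLeft hp i j (by omega) (by omega)) i i hi hi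
  rw [if_pos rfl] at this
  simp only [LinearMap.comp_apply, LinearMap.mulLeft_apply] at this
  rw [mul_assoc, this, h.orthLeft hp i i (by omega) (by omega), if_pos rfl, momentWidth_succ]
  ring

/-- A nonnegative polynomial that controls the moment of order `k + 1` from below. -/
theorem exists_lowerPoly (p : ℕ → ℝ) {k : ℕ} (hk : k < 2 * n + 1) :
    ∃ f : ℝ[X], (f - X ^ (k + 1)).degree < ((k + 1 : ℕ) : WithBot ℕ) ∧
      (∀ x ∈ Icc a b, 0 ≤ f.eval x) ∧
      ∀ p' μ, IsUnitSeq p' → (∀ i ≤ k, p' i = p i) → ∀ h : IsRepresentedBy a b n p' μ,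
        polyIntegral h.mem f = momentWidth a b p k * p' (k + 1) := by
  -- Parity decides the form: odd degree `k + 1` needs the factor `x - a`, even degree a plain
  -- square.
  obtain ⟨j, rfl | rfl⟩ := Nat.even_or_odd' k
  · have hm := orthPolyLeft_monic (a := a) (b := b) (p := p) j
    refine ⟨(X - C a) * (orthPolyLeft a b p j * orthPolyLeft a b p j), ?_, ?_, ?_⟩
    · have h2 := hm.1.mul hm.1
      refine degree_sub_X_pow_lt_of_monic ((monic_X_sub_C a).mul h2) ?_
      rw [(monic_X_sub_C a).natDegree_mul h2, hm.1.natDegree_mul hm.1, hm.2, natDegree_X_sub_C]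
      ring
    · intro x hx
      rw [eval_mul, eval_mul]
      exact mul_nonneg (by simpa using hx.1) (mul_self_nonneg _)
    · intro p' μ hp' hpp h
      rw [← orthPolyLeft_congr hpp, h.orthLeft hp' j j (by omega) (by omega), if_pos rfl,
        momentWidth_congr hpp]
  · have hm := orthPoly_monic (a := a) (b := b) (p := p) (j + 1)
    refine ⟨orthPoly a b p (j + 1) * orthPoly a b p (j + 1), ?_, ?_, ?_⟩
    · refine degree_sub_X_pow_lt_of_monic (hm.1.mul hm.1) ?_
      rw [hm.1.natDegree_mul hm.1, hm.2]
      ring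
    · intro x _
      rw [eval_mul]
      exact mul_self_nonneg _
    · intro p' μ hp' hpp h
      rw [← orthPoly_congr (p := p') fun i hi => hpp i (by omega), h.norm _ (by omega),
        show 2 * (j + 1) = 2 * j + 1 + 1 by ring, prod_chainCoeff hp', momentWidth_congr hpp]

/-- A nonnegative polynomial that controls the moment of order `k + 1` from above. -/
theorem exists_upperPoly (p : ℕ → ℝ) {k : ℕ} (hk : k < 2 * n + 1) :
    ∃ f : ℝ[X], (f + X ^ (k + 1)).degree < ((k + 1 : ℕ) : WithBot ℕ) ∧
      (∀ x ∈ Icc a b, 0 ≤ f.eval x) ∧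
      ∀ p' μ, IsUnitSeq p' → (∀ i ≤ k, p' i = p i) → ∀ h : IsRepresentedBy a b n p' μ,
        polyIntegral h.mem f = momentWidth a b p k * (1 - p' (k + 1)) := by
  obtain ⟨j, rfl | rfl⟩ := Nat.even_or_odd' k
  · have hm := orthPolyRight_monic (a := a) (b := b) (p := p) j
    refine ⟨(C b - X) * (orthPolyRight a b p j * orthPolyRight a b p j), ?_, ?_, ?_⟩
    · have h2 := hm.1.mul hm.1
      have h3 := degree_sub_X_pow_lt_of_monic ((monic_X_sub_C b).mul h2) (k := 2 * j + 1) (by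
        rw [(monic_X_sub_C b).natDegree_mul h2, hm.1.natDegree_mul hm.1, hm.2, natDegree_X_sub_C]
        ring)
      rw [← degree_neg] at h3
      refine lt_of_eq_of_lt (congrArg degree ?_) h3
      ring
    · intro x hx
      rw [eval_mul, eval_mul]
      exact mul_nonneg (by simpa using hx.2) (mul_self_nonneg _)
    · intro p' μ hp' hpp h
      rw [← orthPolyRight_congr hpp, h.orthRight hp' j (by omega), momentWidth_congr hpp]
  · have hm := orthPolyBoth_monic (a := a) (b := b) (p := p) j
    refine ⟨(X - C a) * (C b - X) * (orthPolyBoth a b p j * orthPolyBoth a b p j), ?_, ?_, ?_⟩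
    · have h2 := hm.1.mul hm.1
      have h4 := (monic_X_sub_C a).mul (monic_X_sub_C b)
      have h3 := degree_sub_X_pow_lt_of_monic (h4.mul h2) (k := 2 * j + 1 + 1) (by
        rw [h4.natDegree_mul h2, (monic_X_sub_C a).natDegree_mul (monic_X_sub_C b),
          hm.1.natDegree_mul hm.1, hm.2, natDegree_X_sub_C, natDegree_X_sub_C]
        ring)
      rw [← degree_neg] at h3
      refine lt_of_eq_of_lt (congrArg degree ?_) h3
      ring
    · intro x hx
      rw [eval_mul, eval_mul, eval_mul]
      exact mul_nonneg (mul_nonneg (by simpa using hx.1) (by simpa using hx.2))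
        (mul_self_nonneg _)
    · intro p' μ hp' hpp h
      rw [← orthPolyBoth_congr hpp, h.orthBoth hp' j (by omega), momentWidth_congr hpp]

theorem polyIntegral_eq_add (hμ : μ ∈ probOn a b) (f : ℝ[X]) (k : ℕ) :
    polyIntegral hμ f = ∫ x, x ^ k ∂μ + polyIntegral hμ (f - X ^ k) := by
  rw [map_sub, polyIntegral_X_pow]; ring

theorem polyIntegral_eq_sub (hμ : μ ∈ probOn a b) (f : ℝ[X]) (k : ℕ) :
    polyIntegral hμ f = polyIntegral hμ (f + X ^ k) - ∫ x, x ^ k ∂μ := by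
  rw [map_add, polyIntegral_X_pow]; ring

/-- The moment of order `k + 1` is an affine function of `p (k + 1)`. -/
theorem IsRepresentedBy.moment_succ (hμ : IsRepresentedBy a b n p μ) (hp : IsUnitSeq p)
    (hν : IsRepresentedBy a b n p' ν) (hp' : IsUnitSeq p') {k : ℕ} (hk : k < 2 * n + 1)
    (hpp : ∀ i ≤ k, p' i = p i) (h : ∀ i < k + 1, ∫ x, x ^ i ∂ν = ∫ x, x ^ i ∂μ) :
    ∫ x, x ^ (k + 1) ∂ν = ∫ x, x ^ (k + 1) ∂μ +
      momentWidth a b p k * (p' (k + 1) - p (k + 1)) := by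
  obtain ⟨f, hf, -, hint⟩ := exists_lowerPoly (a := a) (b := b) p hk
  have h1 := hint p μ hp (fun _ _ => rfl) hμ
  have h2 := hint p' ν hp' hpp hν
  rw [polyIntegral_eq_add _ f (k + 1)] at h1 h2
  rw [polyIntegral_congr hν.mem hμ.mem h hf] at h2
  linarith

theorem IsRepresentedBy.moment_congr (hμ : IsRepresentedBy a b n p μ) (hp : IsUnitSeq p)
    (hν : IsRepresentedBy a b n p' ν) (hp' : IsUnitSeq p') {k : ℕ} (hk : k ≤ 2 * n + 1)
    (hpp : ∀ i ≤ k, p' i = p i) (i : ℕ) (hi : i ≤ k) : ∫ x, x ^ i ∂ν = ∫ x, x ^ i ∂μ := by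
  induction i using Nat.strong_induction_on with
  | _ i ih =>
    cases i with
    | zero =>
      have := hμ.mem.1
      have := hν.mem.1
      simp
    | succ i =>
      rw [hμ.moment_succ hp hν hp' (by omega) (fun j hj => hpp j (by omega))
        (fun j hj => ih j hj (by omega)), hpp (i + 1) hi]
      ring

/-- The test polynomial has a nonnegative integral against `ν`, and its part of degree at most `k`
integrates identically against `μ` and `ν`; only the top moment is left to compare. -/
theorem IsRepresentedBy.le_moment (hμ : IsRepresentedBy a b n p μ) (hp : IsUnitSeq p)
    (hν : ν ∈ probOn a b) {k : ℕ} (hk : k < 2 * n + 1)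
    (h : ∀ i < k + 1, ∫ x, x ^ i ∂ν = ∫ x, x ^ i ∂μ) :
    ∫ x, x ^ (k + 1) ∂μ - momentWidth a b p k * p (k + 1) ≤ ∫ x, x ^ (k + 1) ∂ν := by
  obtain ⟨f, hf, hf0, hint⟩ := exists_lowerPoly (a := a) (b := b) p hk
  have h1 := hint p μ hp (fun _ _ => rfl) hμ
  have h2 := polyIntegral_nonneg hν hf0
  rw [polyIntegral_eq_add _ f (k + 1)] at h1 h2
  rw [polyIntegral_congr hν hμ.mem h hf] at h2
  linarith

theorem IsRepresentedBy.moment_le (hμ : IsRepresentedBy a b n p μ) (hp : IsUnitSeq p)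
    (hν : ν ∈ probOn a b) {k : ℕ} (hk : k < 2 * n + 1)
    (h : ∀ i < k + 1, ∫ x, x ^ i ∂ν = ∫ x, x ^ i ∂μ) :
    ∫ x, x ^ (k + 1) ∂ν ≤ ∫ x, x ^ (k + 1) ∂μ + momentWidth a b p k * (1 - p (k + 1)) := by
  obtain ⟨f, hf, hf0, hint⟩ := exists_upperPoly (a := a) (b := b) p hk
  have h1 := hint p μ hp (fun _ _ => rfl) hμ
  have h2 := polyIntegral_nonneg hν hf0
  rw [polyIntegral_eq_sub _ f (k + 1)] at h1 h2
  rw [polyIntegral_congr hν hμ.mem h hf] at h2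
  linarith

/-- The moment of order `k + 1` can be varied while the lower moments are kept. -/
theorem IsRepresentedBy.exists_moment_eq (hab : a < b) (hμ : IsRepresentedBy a b n p μ)
    (hp : IsUnitSeq p) {k : ℕ} (hk : k < 2 * n + 1) {t : ℝ} (ht : t ∈ Icc (0 : ℝ) 1) :
    ∃ ν ∈ probOn a b, (∀ i < k + 1, ∫ x, x ^ i ∂ν = ∫ x, x ^ i ∂μ) ∧
      ∫ x, x ^ (k + 1) ∂ν = ∫ x, x ^ (k + 1) ∂μ + momentWidth a b p k * (t - p (k + 1)) := by
  -- Only the value `t` at `k + 1` matters; the later entries are arbitrary.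
  have hp' : IsUnitSeq fun i => if i ≤ k then p i else t :=
    ⟨by simp [hp.1], fun i => by dsimp only; split_ifs; exacts [hp.2 i, ht]⟩
  obtain ⟨ν, hν, -, -⟩ := exists_isRepresentedBy hab hp' n
  have hpp : ∀ i ≤ k, (fun i => if i ≤ k then p i else t) i = p i := fun i hi => if_pos hi
  have hm : ∀ i < k + 1, ∫ x, x ^ i ∂ν = ∫ x, x ^ i ∂μ := fun i hi =>
    hμ.moment_congr hp hν hp' (by omega) hpp i (by omega)
  refine ⟨ν, hν.mem, hm, ?_⟩
  rw [hμ.moment_succ hp hν hp' hk hpp hm]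
  simp

theorem momentVec_eq_iff (hμ : μ ∈ probOn a b) (hν : ν ∈ probOn a b) {k : ℕ} :
    momentVec k ν = momentVec k μ ↔ ∀ i < k + 1, ∫ x, x ^ i ∂ν = ∫ x, x ^ i ∂μ := by
  constructor
  · intro h i hi
    cases i with
    | zero =>
      have := hμ.1
      have := hν.1
      simp
    | succ i => exact congrFun h ⟨i, by omega⟩
  · intro h
    ext i
    exact h (i + 1) (by omega)

theorem mem_nextMoments_iff (hμ : μ ∈ probOn a b) {k : ℕ} {t : ℝ} :
    t ∈ nextMoments a b (momentVec k μ) ↔ ∃ ν ∈ probOn a b,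
      (∀ i < k + 1, ∫ x, x ^ i ∂ν = ∫ x, x ^ i ∂μ) ∧ ∫ x, x ^ (k + 1) ∂ν = t := by
  have hinit : ∀ ν : Measure ℝ, momentVec (k + 1) ν =
      (Fin.snoc (momentVec k ν) (∫ x, x ^ (k + 1) ∂ν) : Fin (k + 1) → ℝ) := by
    intro ν
    ext i
    refine Fin.lastCases ?_ (fun i => ?_) i
    · rw [Fin.snoc_last]; rfl
    · rw [Fin.snoc_castSucc]; rfl
  simp only [nextMoments, momentSpace, mem_ofPred_eq, mem_image]
  refine exists_congr fun ν => and_congr_right fun hν => ?_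
  rw [← momentVec_eq_iff hμ hν, hinit, Fin.snoc_inj]

theorem IsRepresentedBy.nextMax_eq (hab : a < b) (hμ : IsRepresentedBy a b n p μ)
    (hp : IsUnitSeq p) {k : ℕ} (hk : k < 2 * n + 1) : nextMax a b (momentVec k μ) =
      ∫ x, x ^ (k + 1) ∂μ + momentWidth a b p k * (1 - p (k + 1)) := by
  refine IsGreatest.csSup_eq ⟨(mem_nextMoments_iff hμ.mem).2
    (hμ.exists_moment_eq hab hp hk ⟨zero_le_one, le_rfl⟩), fun t ht => ?_⟩
  obtain ⟨ν, hν, h, rfl⟩ := (mem_nextMoments_iff hμ.mem).1 ht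
  exact hμ.moment_le hp hν hk h

theorem IsRepresentedBy.nextMin_eq (hab : a < b) (hμ : IsRepresentedBy a b n p μ)
    (hp : IsUnitSeq p) {k : ℕ} (hk : k < 2 * n + 1) : nextMin a b (momentVec k μ) =
      ∫ x, x ^ (k + 1) ∂μ - momentWidth a b p k * p (k + 1) := by
  refine IsLeast.csInf_eq ⟨(mem_nextMoments_iff hμ.mem).2 ?_, fun t ht => ?_⟩
  · obtain ⟨ν, h1, h2, h3⟩ := hμ.exists_moment_eq hab hp hk (t := 0) ⟨le_rfl, zero_le_one⟩
    exact ⟨ν, h1, h2, by rw [h3]; ring⟩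
  obtain ⟨ν, hν, h, rfl⟩ := (mem_nextMoments_iff hμ.mem).1 ht
  exact hμ.le_moment hp hν hk h

/-! ### Canonical moments of arbitrary measures. -/

/-- The infinite sequence of the canonical moments of a measure. -/
noncomputable def canonicalSeq (a b : ℝ) (μ : Measure ℝ) : ℕ → ℝ
  | 0 => 0
  | k + 1 => (∫ x, x ^ (k + 1) ∂μ - nextMin a b (momentVec k μ)) /
      (nextMax a b (momentVec k μ) - nextMin a b (momentVec k μ))

/-- Supplies the boundedness without which `sSup` and `sInf` in `nextMax` and `nextMin` would be
junk values. -/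
theorem abs_moment_le (hμ : μ ∈ probOn a b) (k : ℕ) :
    |∫ x, x ^ k ∂μ| ≤ (max |a| |b|) ^ k := by
  have := hμ.1
  have h := norm_integral_le_of_norm_le_const (μ := μ) (f := fun x : ℝ => x ^ k)
    (C := (max |a| |b|) ^ k) ((ae_mem_Icc hμ).mono fun x hx => by
      rw [norm_pow, Real.norm_eq_abs]
      exact pow_le_pow_left₀ (abs_nonneg x) (abs_le_max_abs_abs hx.1 hx.2) k)
  simpa using h

theorem nextMin_le_moment (hμ : μ ∈ probOn a b) (k : ℕ) :
    nextMin a b (momentVec k μ) ≤ ∫ x, x ^ (k + 1) ∂μ := by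
  refine csInf_le ⟨-(max |a| |b|) ^ (k + 1), fun t ht => ?_⟩
    ((mem_nextMoments_iff hμ).2 ⟨μ, hμ, fun _ _ => rfl, rfl⟩)
  obtain ⟨ν, hν, -, rfl⟩ := (mem_nextMoments_iff hμ).1 ht
  exact (abs_le.1 (abs_moment_le hν (k + 1))).1

theorem moment_le_nextMax (hμ : μ ∈ probOn a b) (k : ℕ) :
    ∫ x, x ^ (k + 1) ∂μ ≤ nextMax a b (momentVec k μ) := by
  refine le_csSup ⟨(max |a| |b|) ^ (k + 1), fun t ht => ?_⟩
    ((mem_nextMoments_iff hμ).2 ⟨μ, hμ, fun _ _ => rfl, rfl⟩)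
  obtain ⟨ν, hν, -, rfl⟩ := (mem_nextMoments_iff hμ).1 ht
  exact (abs_le.1 (abs_moment_le hν (k + 1))).2

theorem isUnitSeq_canonicalSeq (hμ : μ ∈ probOn a b) : IsUnitSeq (canonicalSeq a b μ) := by
  refine ⟨rfl, fun k => ?_⟩
  cases k with
  | zero => exact ⟨le_rfl, zero_le_one⟩
  | succ k =>
    have h1 := nextMin_le_moment hμ k
    have h2 := moment_le_nextMax hμ k
    exact ⟨div_nonneg (by linarith) (by linarith), div_le_one_of_le₀ (by linarith) (by linarith)⟩

/-- The canonical moments determine the moments. -/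
theorem IsRepresentedBy.moment_eq_of_canonicalSeq (hab : a < b) (hμ : IsRepresentedBy a b n p μ)
    (hp : IsUnitSeq p) (hν : ν ∈ probOn a b) {K : ℕ} (hK : K ≤ 2 * n + 1)
    (h : ∀ i ≤ K, canonicalSeq a b ν i = p i) :
    ∀ i < K + 1, ∫ x, x ^ i ∂ν = ∫ x, x ^ i ∂μ := by
  intro i
  induction i using Nat.strong_induction_on with
  | _ i ih =>
    intro hi
    cases i with
    | zero => exact (momentVec_eq_iff hμ.mem hν (k := 0)).1 (Subsingleton.elim _ _) 0 Nat.one_pos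
    | succ i =>
      have ih' : ∀ j < i + 1, ∫ x, x ^ j ∂ν = ∫ x, x ^ j ∂μ := fun j hj => ih j hj (by omega)
      have h1 := h (i + 1) (by omega)
      rw [canonicalSeq, (momentVec_eq_iff hμ.mem hν).2 ih', hμ.nextMax_eq hab hp (by omega),
        hμ.nextMin_eq hab hp (by omega)] at h1
      by_cases hw : momentWidth a b p i = 0
      -- With width zero the canonical moment carries no information, but the two bounds coincide
      -- and force the moment.
      · have h2 := hμ.le_moment hp hν (by omega) ih'
        have h3 := hμ.moment_le hp hν (by omega) ih'
        rw [hw] at h2 h3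
        linarith
      · rw [div_eq_iff (by ring_nf; exact hw)] at h1
        linarith

theorem IsRepresentedBy.canonicalSeq_succ (hab : a < b) (hμ : IsRepresentedBy a b n p μ)
    (hp : IsUnitSeq p) {k : ℕ} (hk : k < 2 * n + 1) : canonicalSeq a b μ (k + 1) =
      if momentWidth a b p k = 0 then 0 else p (k + 1) := by
  rw [canonicalSeq, hμ.nextMax_eq hab hp hk, hμ.nextMin_eq hab hp hk]
  split_ifs with h
  · simp [h]
  · rw [div_eq_iff (by ring_nf; exact h)]
    ring

/-- Realising the canonical sequence of `ν` itself gives a measure with the same lower moments and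
an explicit width, which has a vanishing factor; the quotient is then `0 / 0`. -/
theorem canonicalSeq_eq_zero (hab : a < b) (hν : ν ∈ probOn a b) {i k : ℕ} (hi : 1 ≤ i)
    (hik : i < k) (h : canonicalSeq a b ν i = 0 ∨ canonicalSeq a b ν i = 1) :
    canonicalSeq a b ν k = 0 := by
  obtain ⟨k, rfl⟩ : ∃ l, k = l + 1 := ⟨k - 1, by omega⟩
  have hp := isUnitSeq_canonicalSeq hν
  obtain ⟨μ, hμ, -, -⟩ := exists_isRepresentedBy hab hp k
  have hw : momentWidth a b (canonicalSeq a b ν) k = 0 :=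
    (momentWidth_eq_zero_iff hab k).2 ⟨i, hi, by omega, h⟩
  rw [canonicalSeq, (momentVec_eq_iff hμ.mem hν).2
    (hμ.moment_eq_of_canonicalSeq hab hp hν (by omega) fun _ _ => rfl),
    hμ.nextMax_eq hab hp (by omega), hμ.nextMin_eq hab hp (by omega), hw]
  simp

/-! ### Uniqueness on finite sets. -/

/-- Measures carried by a finite set are determined by as many moments as it has points. -/
theorem measure_eq_of_finset (hμ : μ ∈ probOn a b) (hν : ν ∈ probOn a b) (Z : Finset ℝ)
    (hμZ : μ (Z : Set ℝ)ᶜ = 0) (hνZ : ν (Z : Set ℝ)ᶜ = 0)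
    (h : ∀ i < Z.card, ∫ x, x ^ i ∂μ = ∫ x, x ^ i ∂ν) : μ = ν := by
  classical
  have := hμ.1
  have := hν.1
  ext s hs
  -- A polynomial of degree below `Z.card` that agrees on `Z` with the indicator of `s`, so its
  -- integral is the mass of `s`.
  set f := Lagrange.interpolate Z id (s.indicator 1) with hf
  have hdeg : f.degree < (Z.card : WithBot ℕ) := by
    exact Lagrange.degree_interpolate_lt _ (Set.injOn_id _)
  have key : ∀ {ρ : Measure ℝ} (hρ : ρ ∈ probOn a b), ρ (Z : Set ℝ)ᶜ = 0 →
      polyIntegral hρ f = ρ.real s := by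
    intro ρ hρ hZ
    rw [← integral_indicator_one hs, polyIntegral_apply]
    refine integral_congr_ae ?_
    have hZ' : ∀ᵐ x ∂ρ, x ∈ (Z : Set ℝ) := (mem_ae_iff (s := (Z : Set ℝ))).2 hZ
    filter_upwards [hZ'] with x hx
    exact Lagrange.eval_interpolate_at_node (v := id) _ (Set.injOn_id _) hx
  have h1 := key hμ hμZ
  rw [polyIntegral_congr hμ hν h hdeg, key hν hνZ] at h1
  exact ((ENNReal.toReal_eq_toReal_iff' (measure_ne_top ν s) (measure_ne_top μ s)).1 h1).symm

/-! ### Interior points of the moment space. -/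

theorem convex_momentSpace (a b : ℝ) (n : ℕ) : Convex ℝ (momentSpace a b n) := by
  rintro _ ⟨μ, hμ, rfl⟩ _ ⟨ν, hν, rfl⟩ s t hs ht hst
  have := hμ.1
  have := hν.1
  refine ⟨s.toNNReal • μ + t.toNNReal • ν, ⟨⟨?_⟩, ?_⟩, ?_⟩
  · have h1 : s.toNNReal + t.toNNReal = 1 := by
      rw [← Real.toNNReal_add hs ht, hst, Real.toNNReal_one]
    simp only [Measure.add_apply, Measure.smul_apply, measure_univ, ENNReal.smul_def, smul_eq_mul,
      mul_one]
    exact_mod_cast h1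
  · simp [hμ.2, hν.2]
  · ext i
    have h : ∀ (r : NNReal) {ρ : Measure ℝ}, ρ ∈ probOn a b →
        Integrable (fun x => x ^ ((i : ℕ) + 1)) (r • ρ) := fun r ρ hρ =>
      (integrable_of_continuous hρ (continuous_pow _)).smul_measure_nnreal
    simp only [momentVec, Pi.add_apply, Pi.smul_apply]
    rw [integral_add_measure (h _ hμ) (h _ hν), integral_smul_nnreal_measure,
      integral_smul_nnreal_measure, NNReal.smul_def, NNReal.smul_def, Real.coe_toNNReal s hs,
      Real.coe_toNNReal t ht]

/-- A convex set in a finite-dimensional space has a supporting functional at each of its points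
that is not interior. -/
theorem exists_supporting_functional {E : Type*} [NormedAddCommGroup E] [NormedSpace ℝ E]
    [FiniteDimensional ℝ E] {s : Set E} (hs : Convex ℝ s) {c : E} (hc : c ∈ s)
    (hci : c ∉ interior s) : ∃ f : E →ₗ[ℝ] ℝ, f ≠ 0 ∧ ∀ d ∈ s, f d ≤ f c := by
  -- With empty interior, `s` spans a proper affine subspace and a functional constant on it works;
  -- otherwise Hahn–Banach separates `c` from the open interior.
  rcases (interior s).eq_empty_or_nonempty with h | h
  · have hspan : affineSpan ℝ s ≠ ⊤ := fun h' =>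
      (hs.interior_nonempty_iff_affineSpan_eq_top.2 h').ne_empty h
    have hdir : (affineSpan ℝ s).direction < ⊤ := by
      refine lt_top_iff_ne_top.2 fun h' => hspan ?_
      exact (AffineSubspace.direction_eq_top_iff_of_nonempty
        ⟨c, subset_affineSpan ℝ s hc⟩).1 h'
    obtain ⟨f, hf, hle⟩ := Submodule.exists_le_ker_of_lt_top _ hdir
    refine ⟨f, hf, fun d hd => ?_⟩
    have : d - c ∈ (affineSpan ℝ s).direction :=
      AffineSubspace.vsub_mem_direction (subset_affineSpan ℝ s hd) (subset_affineSpan ℝ s hc)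
    have := LinearMap.mem_ker.1 (hle this)
    rw [map_sub] at this
    linarith
  · obtain ⟨f, hf⟩ := geometric_hahn_banach_open_point hs.interior isOpen_interior hci
    refine ⟨f, ?_, fun d hd => ?_⟩
    · rintro h0
      obtain ⟨y, hy⟩ := h
      have := hf y hy
      have h1 : ∀ z, f z = 0 := fun z => LinearMap.congr_fun h0 z
      rw [h1, h1] at this
      exact lt_irrefl _ this
    · have hd' : d ∈ closure (interior s) := by
        rw [hs.closure_interior_eq_closure_of_nonempty_interior h]
        exact subset_closure hd
      have hcl : IsClosed {z | f z ≤ f c} := isClosed_le f.continuous continuous_const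
      exact closure_minimal (fun z hz => (hf z hz).le) hcl hd'

/-- A moment vector is interior to the moment space if and only if its canonical moments avoid
`0` and `1`. -/
theorem momentVec_mem_interior_iff (hab : a < b) (hν : ν ∈ probOn a b) (n : ℕ) :
    momentVec n ν ∈ interior (momentSpace a b n) ↔
      ∀ i, 1 ≤ i → i ≤ n → ¬(canonicalSeq a b ν i = 0 ∨ canonicalSeq a b ν i = 1) := by
  have hp := isUnitSeq_canonicalSeq hν
  obtain ⟨μ, hμ, -, -⟩ := exists_isRepresentedBy hab hp n
  have hνμ : momentVec n ν = momentVec n μ := (momentVec_eq_iff hμ.mem hν).2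
    (hμ.moment_eq_of_canonicalSeq hab hp hν (by omega) fun _ _ => rfl)
  rw [hνμ]
  constructor
  · intro hc i hi1 hin h01
    obtain ⟨k, rfl⟩ : ∃ l, i = l + 1 := ⟨i - 1, by omega⟩
    -- Interiority would let coordinate `k` move both ways with the others fixed, but it is already
    -- extreme when the canonical moment is `0` or `1`.
    have hcont : Continuous fun t : ℝ => momentVec n μ + t • Pi.single ⟨k, hin⟩ (1 : ℝ) := by
      fun_prop
    have hev : ∀ᶠ t in nhds (0 : ℝ),
        momentVec n μ + t • Pi.single ⟨k, hin⟩ (1 : ℝ) ∈ momentSpace a b n := by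
      refine hcont.continuousAt.eventually ?_
      simpa using mem_interior_iff_mem_nhds.1 hc
    have hstep : ∀ t : ℝ, momentVec n μ + t • Pi.single ⟨k, hin⟩ (1 : ℝ) ∈ momentSpace a b n →
        ∃ ρ ∈ probOn a b, (∀ i < k + 1, ∫ x, x ^ i ∂ρ = ∫ x, x ^ i ∂μ) ∧
          ∫ x, x ^ (k + 1) ∂ρ = ∫ x, x ^ (k + 1) ∂μ + t := by
      rintro t ⟨ρ, hρ, h⟩
      refine ⟨ρ, hρ, (momentVec_eq_iff hμ.mem hρ).1 (funext fun i => ?_), ?_⟩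
      · have h1 := congrFun h ⟨i, by omega⟩
        have h2 : (⟨i, by omega⟩ : Fin n) ≠ ⟨k, hin⟩ := by
          rw [Ne, Fin.mk.injEq]; omega
        simpa [momentVec, h2] using h1
      · simpa [momentVec] using congrFun h ⟨k, hin⟩
    rcases h01 with h0 | h1
    · obtain ⟨t, ht, ht0⟩ := ((hev.filter_mono nhdsWithin_le_nhds).and
        (self_mem_nhdsWithin : Iio (0 : ℝ) ∈ nhdsWithin 0 (Iio 0))).exists
      obtain ⟨ρ, hρ, h2, h3⟩ := hstep t ht
      have h4 := hμ.le_moment hp hρ (by omega) h2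
      rw [h3, h0] at h4
      have : t < 0 := ht0
      linarith
    · obtain ⟨t, ht, ht0⟩ := ((hev.filter_mono nhdsWithin_le_nhds).and
        (self_mem_nhdsWithin : Ioi (0 : ℝ) ∈ nhdsWithin 0 (Ioi 0))).exists
      obtain ⟨ρ, hρ, h2, h3⟩ := hstep t ht
      have h4 := hμ.moment_le hp hρ (by omega) h2
      rw [h3, h1] at h4
      have : 0 < t := ht0
      linarith
  · intro h01
    by_contra hci
    obtain ⟨f, hf0, hf⟩ := exists_supporting_functional (convex_momentSpace a b n)
      ⟨μ, hμ.mem, rfl⟩ hci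
    have hex : ∃ j : Fin n, f (Pi.single j 1) ≠ 0 := by
      by_contra! hall
      exact hf0 (LinearMap.pi_ext' fun j => LinearMap.ext_ring (by simpa using hall j))
    -- Take the last coordinate on which `f` depends: varying that moment fixes the earlier ones,
    -- and `f` ignores whatever happens to the later ones. Moving it both ways contradicts
    -- maximality at `c`.
    obtain ⟨j, hj, hmax⟩ :=
      (Finset.univ.filter fun j : Fin n => f (Pi.single j 1) ≠ 0).exists_max_image id (by obtain ⟨j, hj⟩ := hex; exact ⟨j, by simpa using hj⟩)
    have hj0 : f (Pi.single j 1) ≠ 0 := by simpa using hj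
    have hw : 0 < momentWidth a b (canonicalSeq a b ν) j := by
      refine lt_of_le_of_ne (momentWidth_nonneg hab hp _) fun h0 => ?_
      obtain ⟨i, hi1, hij, h⟩ := (momentWidth_eq_zero_iff hab _).1 h0.symm
      exact h01 i hi1 (by omega) h
    have hdiff : ∀ t ∈ Icc (0 : ℝ) 1, momentWidth a b (canonicalSeq a b ν) j *
        (t - canonicalSeq a b ν (j + 1)) * f (Pi.single j 1) ≤ 0 := by
      intro t ht
      obtain ⟨ρ, hρ, h1, h2⟩ := hμ.exists_moment_eq hab hp (k := j) (by omega) ht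
      have h3 := hf _ ⟨ρ, hρ, rfl⟩
      rw [← sub_nonpos, ← map_sub, LinearMap.pi_apply_eq_sum_univ f, Finset.sum_eq_single j] at h3
      · have h4 : (fun i => if j = i then (1 : ℝ) else 0) = Pi.single j 1 := by
          ext i; simp [Pi.single_apply, eq_comm]
        rw [h4] at h3
        simp only [Pi.sub_apply, momentVec, h2, smul_eq_mul, add_sub_cancel_left] at h3
        exact h3
      · intro i _ hij
        rcases lt_or_gt_of_ne hij with h | h
        · have : momentVec n ρ i = momentVec n μ i := h1 (i + 1) (by simpa using h)
          simp [this]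
        · have h4 : (fun l => if i = l then (1 : ℝ) else 0) = Pi.single i 1 := by
            ext l; simp [Pi.single_apply, eq_comm]
          have h5 : f (Pi.single i 1) = 0 := by
            by_contra h6
            exact absurd (hmax i (by simpa using h6)) (not_le.2 h)
          rw [h4, h5, smul_zero]
      · simp
    have hpj := hp.2 (j + 1)
    have hpj' := not_or.1 (h01 (j + 1) (by omega) (by omega))
    have h0 : 0 < canonicalSeq a b ν (j + 1) := lt_of_le_of_ne hpj.1 (Ne.symm hpj'.1)
    have h1 : canonicalSeq a b ν (j + 1) < 1 := lt_of_le_of_ne hpj.2 hpj'.2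
    have e0 := hdiff 0 ⟨le_rfl, zero_le_one⟩
    have e1 := hdiff 1 ⟨zero_le_one, le_rfl⟩
    rcases lt_or_gt_of_ne hj0 with h | h
    · have := mul_pos (mul_pos hw h0) (neg_pos.2 h)
      linarith
    · have := mul_pos (mul_pos hw (sub_pos.2 h1)) h
      linarith

/-! ### Tails of canonical moments and discrete measures. -/

theorem entry_append_left {m : ℕ} (p : Fin n → ℝ) (q : Fin m → ℝ) {k : ℕ} (hk : k < n) :
    entry (Fin.append p q) (k + 1) = p ⟨k, hk⟩ := by
  rw [entry, dif_pos (by omega)]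
  exact Fin.append_left p q ⟨k, hk⟩

theorem entry_append_right {m : ℕ} (p : Fin n → ℝ) (q : Fin m → ℝ) (k : Fin m) :
    entry (Fin.append p q) (n + k + 1) = q k := by
  rw [entry, dif_pos (by omega)]
  exact Fin.append_right p q k

theorem isUnitSeq_entry {N : ℕ} {p : Fin N → ℝ} (hp : ∀ i, p i ∈ Icc (0 : ℝ) 1) :
    IsUnitSeq (entry p) := by
  refine ⟨rfl, fun k => ?_⟩
  cases k with
  | zero => exact ⟨le_rfl, zero_le_one⟩
  | succ k =>
    rw [entry]
    split_ifs
    exacts [hp _, ⟨le_rfl, zero_le_one⟩]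

theorem tailMoments_apply (μ : Measure ℝ) (i : Fin (n + 1)) :
    tailMoments a b n μ i = canonicalSeq a b μ (n + i + 1) := rfl

theorem append_tailMoments (μ : Measure ℝ) (i : Fin (n + (n + 1))) :
    Fin.append (canonicalMoments a b (momentVec n μ)) (tailMoments a b n μ) i =
      canonicalSeq a b μ (i + 1) := by
  refine Fin.addCases (fun i => ?_) (fun i => ?_) i
  · rw [Fin.append_left]; rfl
  · rw [Fin.append_right]; rfl

theorem tailMoments_mem (hab : a < b) (hμ : μ ∈ probOn a b) :
    tailMoments a b n μ ∈ GammaAfter (canonicalMoments a b (momentVec n μ)) := by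
  refine ⟨fun i => (isUnitSeq_canonicalSeq hμ).2 (n + i + 1), fun i k hik h => ?_⟩
  rw [append_tailMoments] at h
  have hik' : (i : ℕ) < n + k := hik
  rw [tailMoments_apply]
  exact canonicalSeq_eq_zero hab hμ (i := i + 1) (by omega) (by omega) h

theorem GammaAfter_eq_Gamma {L : Fin n → ℝ} (hL : ∀ i, ¬(L i = 0 ∨ L i = 1)) :
    GammaAfter L = Gamma n := by
  ext q
  refine and_congr_right fun _ => ⟨fun h i k hik hi => ?_, fun h i k => ?_⟩
  · exact h (Fin.natAdd n i) k (by simpa using hik) (by rwa [Fin.append_right])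
  · refine Fin.addCases (fun i => ?_) (fun i => ?_) i
    · rw [Fin.append_left]
      exact fun _ hi => absurd hi (hL i)
    · rw [Fin.append_right]
      exact fun hik hi => h i k (by simpa using hik) hi

theorem GammaAfter_eq_zero {L : Fin n → ℝ} {i : Fin n} (hi : L i = 0 ∨ L i = 1) :
    GammaAfter L = {0} := by
  ext q
  refine ⟨fun h => funext fun k => h.2 (Fin.castAdd (n + 1) i) k ?_ (by rwa [Fin.append_left]), ?_⟩
  · rw [Fin.lt_def, Fin.val_castAdd, Fin.val_natAdd]
    omega
  · rintro rfl
    exact ⟨fun _ => ⟨le_rfl, zero_le_one⟩, fun _ _ _ _ => rfl⟩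

theorem measure_compl_image_eq_zero {N : ℕ} (w : Fin N → NNReal) (x : Fin N → ℝ) {Z : Finset ℝ}
    (hZ : ∀ i, x i ∈ Z) : (∑ i, w i • Measure.dirac (x i)) (Z : Set ℝ)ᶜ = 0 := by
  rw [Measure.finsetSum_apply]
  refine Finset.sum_eq_zero fun i _ => ?_
  rw [Measure.smul_apply, Measure.dirac_apply' _ Z.measurableSet.compl]
  simp [hZ i]

theorem injOn_tailMoments (hab : a < b) (c : Fin n → ℝ) :
    InjOn (tailMoments a b n) (discreteMeasures a b c) := by
  classical
  rintro μ ⟨hμ, ⟨w, x, -, hw⟩, hμc⟩ ν ⟨hν, ⟨w', x', -, hw'⟩, hνc⟩ h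
  have hp := isUnitSeq_canonicalSeq hμ
  obtain ⟨ρ, hρ, -, -⟩ := exists_isRepresentedBy hab hp n
  have hseq : ∀ i ≤ 2 * n + 1, canonicalSeq a b ν i = canonicalSeq a b μ i := by
    intro i hi
    cases i with
    | zero => rfl
    | succ i =>
      have h1 := append_tailMoments (a := a) (b := b) μ (⟨i, by omega⟩ : Fin (n + (n + 1)))
      have h2 := append_tailMoments (a := a) (b := b) ν (⟨i, by omega⟩ : Fin (n + (n + 1)))
      rw [hμc, h] at h1
      rw [hνc, h1] at h2
      exact h2.symm
  have h1 := hρ.moment_eq_of_canonicalSeq hab hp hμ le_rfl fun _ _ => rfl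
  have h2 := hρ.moment_eq_of_canonicalSeq hab hp hν le_rfl hseq
  -- At most `2n + 2` points, matched by the moments of orders `0` to `2n + 1`.
  refine measure_eq_of_finset hμ hν (Finset.univ.image x ∪ Finset.univ.image x') ?_ ?_
    fun i hi => ?_
  · rw [hw]
    exact measure_compl_image_eq_zero w x fun i => by simp
  · rw [hw']
    exact measure_compl_image_eq_zero w' x' fun i => by simp
  · have hc1 := Finset.card_union_le (Finset.univ.image x) (Finset.univ.image x')
    have hc2 : (Finset.univ.image x).card ≤ n + 1 := by
      simpa using Finset.card_image_le (s := Finset.univ) (f := x)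
    have hc3 : (Finset.univ.image x').card ≤ n + 1 := by
      simpa using Finset.card_image_le (s := Finset.univ) (f := x')
    rw [h1 i (by omega), h2 i (by omega)]

/-- A tail of canonical moments is realised by a discrete measure on the roots of the support
polynomial. -/
theorem exists_discreteMeasure (hab : a < b) {c : Fin n → ℝ} (hc : c ∈ momentSpace a b n)
    {q : Fin (n + 1) → ℝ} (hq : q ∈ GammaAfter (canonicalMoments a b c)) :
    (supportPoly a b c q).roots.card = n + 1 ∧
    (∀ x ∈ (supportPoly a b c q).roots, x ∈ Icc a b) ∧
    ∃ μ ∈ discreteMeasures a b c, tailMoments a b n μ = q ∧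
      μ {x | (supportPoly a b c q).IsRoot x}ᶜ = 0 := by
  obtain ⟨ν, hν, rfl⟩ := hc
  set L := canonicalMoments a b (momentVec n ν) with hL
  have hp : IsUnitSeq (entry (Fin.append L q)) := by
    refine isUnitSeq_entry fun i => ?_
    refine Fin.addCases (fun i => ?_) (fun i => ?_) i
    · rw [Fin.append_left]
      exact (isUnitSeq_canonicalSeq hν).2 (i + 1)
    · rw [Fin.append_right]
      exact hq.1 i
  rw [supportPoly, ← hL, Pstar_eq_orthPoly]
  obtain ⟨μ, hμ, hdisc, hroot⟩ := exists_isRepresentedBy hab hp n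
  have hmom : momentVec n μ = momentVec n ν := by
    refine ((momentVec_eq_iff hμ.mem hν).2 (hμ.moment_eq_of_canonicalSeq hab hp hν (by omega)
      fun i hi => ?_)).symm
    cases i with
    | zero => rfl
    | succ i => rw [entry_append_left L q hi]; rfl
  refine ⟨card_roots_orthPoly hp _, fun x hx =>
      orthPoly_root_mem_Icc hab hp (isRoot_of_mem_roots hx),
    μ, ⟨hμ.mem, hdisc, hmom⟩, funext fun k => ?_, hroot⟩
  rw [tailMoments_apply, hμ.canonicalSeq_succ hab hp (by omega), entry_append_right]
  split_ifs with hw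
  -- Zero width means an earlier entry is `0` or `1`; the defining condition of `GammaAfter` then
  -- makes `q k` agree with the `0 / 0` convention.
  · obtain ⟨i, hi1, hik, hi⟩ := (momentWidth_eq_zero_iff hab _).1 hw
    obtain ⟨i, rfl⟩ : ∃ l, i = l + 1 := ⟨i - 1, by omega⟩
    rw [entry, dif_pos (by omega)] at hi
    refine (hq.2 ⟨i, by omega⟩ k ?_ hi).symm
    rw [Fin.lt_def, Fin.val_natAdd]
    exact hik
  · rfl

end CanonicalMoments

theorem corollary1 (a b : ℝ) (hab : a < b) (n : ℕ) (c : Fin n → ℝ)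
    (hc : c ∈ CanonicalMoments.momentSpace a b n) :
    -- for an interior point of the moment space the tails are exactly those in `Γ`;
    -- for a boundary point the only possible tail is `0`
    (c ∈ interior (CanonicalMoments.momentSpace a b n) →
      CanonicalMoments.GammaAfter (CanonicalMoments.canonicalMoments a b c) =
        CanonicalMoments.Gamma n) ∧
    (c ∈ frontier (CanonicalMoments.momentSpace a b n) →
      CanonicalMoments.GammaAfter (CanonicalMoments.canonicalMoments a b c) = {0}) ∧
    -- the tail of the canonical moments is a bijection from `𝒜_Δ` onto the set of tails
    Set.BijOn (CanonicalMoments.tailMoments a b n)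
      (CanonicalMoments.discreteMeasures a b c)
      (CanonicalMoments.GammaAfter (CanonicalMoments.canonicalMoments a b c)) ∧
    -- its inverse is given by the roots of `P_*^{(n+1)}`
    ∀ q ∈ CanonicalMoments.GammaAfter (CanonicalMoments.canonicalMoments a b c),
      (CanonicalMoments.supportPoly a b c q).roots.card = n + 1 ∧
      (∀ x ∈ (CanonicalMoments.supportPoly a b c q).roots, x ∈ Set.Icc a b) ∧
      ∃ μ ∈ CanonicalMoments.discreteMeasures a b c,
        CanonicalMoments.tailMoments a b n μ = q ∧
        μ.support ⊆ {x | (CanonicalMoments.supportPoly a b c q).IsRoot x} ∧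
        (μ.support.ncard = n + 1 →
          μ.support = {x | (CanonicalMoments.supportPoly a b c q).IsRoot x}) ∧
        ∀ ν : MeasureTheory.Measure ℝ,
          (ν ∈ CanonicalMoments.probOn a b ∧
            ν {x | (CanonicalMoments.supportPoly a b c q).IsRoot x}ᶜ = 0 ∧
            CanonicalMoments.momentVec n ν = c) ↔ ν = μ := by
  classical
  open CanonicalMoments in
  refine ⟨fun hi => ?_, fun hf => ?_, ⟨?_, injOn_tailMoments hab c, ?_⟩, fun q hq => ?_⟩
  · obtain ⟨ν, hν, rfl⟩ := hc
    exact GammaAfter_eq_Gamma fun i =>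
      (momentVec_mem_interior_iff hab hν n).1 hi (i + 1) (by omega) (by omega)
  · obtain ⟨ν, hν, rfl⟩ := hc
    have hni := (momentVec_mem_interior_iff hab hν n).not.1 hf.2
    push Not at hni
    obtain ⟨i, hi1, hin, hi⟩ := hni
    obtain ⟨i, rfl⟩ : ∃ l, i = l + 1 := ⟨i - 1, by omega⟩
    exact GammaAfter_eq_zero (i := ⟨i, hin⟩) hi
  · rintro μ ⟨hμ, -, rfl⟩
    exact tailMoments_mem hab hμ
  · intro q hq
    obtain ⟨-, -, μ, hμ, hμq, -⟩ := exists_discreteMeasure hab hc hq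
    exact ⟨μ, hμ, hμq⟩
  · obtain ⟨hcard, hroots, μ, hμ, hμq, hnull⟩ := exists_discreteMeasure hab hc hq
    have hne : supportPoly a b c q ≠ 0 := by
      intro h
      rw [h] at hcard
      simp at hcard
    set Z := (supportPoly a b c q).roots.toFinset with hZ
    have hset : {x | (supportPoly a b c q).IsRoot x} = (Z : Set ℝ) := by
      ext x
      simp [hZ, hne]
    -- Roots may coincide, so only an upper bound holds; it suffices, since total mass and `c` fix
    -- `n + 1` moments.
    have hZcard : Z.card ≤ n + 1 := hcard ▸ Multiset.toFinset_card_le _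
    rw [hset] at hnull ⊢
    have hsupp : μ.support ⊆ (Z : Set ℝ) :=
      Measure.support_subset_of_isClosed Z.finite_toSet.isClosed (mem_ae_iff.2 hnull)
    refine ⟨hcard, hroots, μ, hμ, hμq, hsupp, fun h => ?_, fun ν => ⟨?_, ?_⟩⟩
    · exact Set.eq_of_subset_of_ncard_le hsupp (by rw [h, Set.ncard_coe_finset]; exact hZcard)
        Z.finite_toSet
    · rintro ⟨hν, hνZ, hνc⟩
      exact measure_eq_of_finset hν hμ.1 Z hνZ hnull fun i hi =>
        (momentVec_eq_iff hμ.1 hν).1 (hνc.trans hμ.2.2.symm) i (by omega)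
    · rintro rfl
      exact ⟨hμ.1, hnull, hμ.2.2⟩
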